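/- Let $n\ge 1$, let $\Omega\subset\mathbb R^n$ be a bounded domain, $\varepsilon>0$, $\alpha,\beta>0$ with $\alpha+\beta=1$. Let $\Gamma_\varepsilon=\{x\in\mathbb R^n\setminus\Omega:\operatorname{dist}(x,\Omega)\le\varepsilon\}$, $\Omega_\varepsilon=\Omega\cup\Gamma_\varepsilon$ and $\Gamma_{\varepsilon,\varepsilon}=\{x\in\mathbb R^n:\operatorname{dist}(x,\partial\Omega)\le\varepsilon\}$, and let $F:\Gamma_{\varepsilon,\varepsilon}\to\mathbb R$ be continuous (hence bounded). Put $\delta(x)=1-\varepsilon^{-1}\operatorname{dist}(x,\Gamma_\varepsilon)$ for $x\in\Gamma_{\varepsilon,\varepsilon}$ and $\delta(x)=0$ for $x\in\Omega\setminus\Gamma_{\varepsilon,\varepsilon}$. $B_\varepsilon(x)$ denotes the open ball. Consider the following two-player zero-sum game, started at a point $x_0\in\Omega_\varepsilon$. When the token is at $x_k$, a coin stops the game with probability $\delta(x_k)$; then $\tau=k$ and Player II pays Player I the amount $F(x_\tau)$. Otherwise the token moves to a point $x_{k+1}\in B_\varepsilon(x_k)$: with probability $\alpha/2$ the point is chosen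 by Player I, with probability $\alpha/2$ it is chosen by Player II, and with probability $\beta$ it is uniformly distributed in $B_\varepsilon(x_k)$; let $c_{k+1}\in\{0,1,2\}$ record which of the three cases occurs. A strategy is a sequence of Borel functions which give the next point in $B_\varepsilon(x_k)$ as a function of the history $(x_0,(c_1,x_1),\dots,(c_k,x_k))$. Fix one of the following alternatives for the information that both players' strategies may use: 1. only the current point $x_k$ (in either of two readings: the same rule is used in all rounds, or the rule may also depend on $k$); 2. the full history of points $x_0,\dots,x_k$; 3. the full history of points and of coin tosses $c_1,\dots,c_k$. Let $$u_{\mathrm I}(x_0)=\sup_{S_{\mathrm I}}\inf_{S_{\mathrm{II}}}\mathbb E^{x_0}_{S_{\mathrm I},S_{\mathrm{II}}}[F(x_\tau)],\qquad u_{\mathrm{II}}(x_0)=\inf_{S_{\mathrm{II}}}\sup_{S_{\mathrm I}}\mathbb E^{x_0}_{S_{\mathrm I},S_{\mathrm{II}}}[F(x_\tau)],$$ where $S_{\mathrm I},S_{\mathrm{II}}$ range over the strategies allowed by the alternative. Then, for all strategies and all $x_0\in\Omega_\varepsilon$, the game is almost surely stopped, at a point of $\Gamma_{\varepsilon,\varepsilon}$,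 and $F(x_\tau)$ is integrable. Moreover, there is exactly one continuous function $u:\Omega_\varepsilon\to\mathbb R$ such that $$u(x)=(1-\delta(x))\Big(\frac\alpha2\sup_{B_\varepsilon(x)}u+\frac\alpha2\inf_{B_\varepsilon(x)}u+\frac{\beta}{|B_\varepsilon(x)|}\int_{B_\varepsilon(x)}u\,dy\Big)+\delta(x)F(x)\qquad\text{for all }x\in\Omega_\varepsilon,$$ where the first summand is $0$ if $\delta(x)=1$ (in particular for $x\in\Gamma_\varepsilon$), and the second summand is $0$ if $x\in\Omega\setminus\Gamma_{\varepsilon,\varepsilon}$. For each of the alternatives, the game has a value, and the value is this same function: $u_{\mathrm I}(x_0)=u_{\mathrm{II}}(x_0)=u(x_0)$ for all $x_0\in\Omega_\varepsilon$. -/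

import Mathlib

open MeasureTheory ProbabilityTheory Set Filter
open scoped ENNReal

noncomputable section

/-- The result of a round: Player I moves, Player II moves, the token moves at random, or the
game is stopped by the extra coin.  `start` is the formal label of the initial state. -/
inductive Outcome
  | start
  | playerI
  | playerII
  | noise
  | stopped

instance : MeasurableSpace Outcome := ⊤

/-- The state after a round: the outcome of the round together with the new token position. -/
abbrev Round (n : ℕ) : Type := Outcome × EuclideanSpace ℝ (Fin n)

/-- The history `(start, x₀), (c₁, x₁), …, (c_k, x_k)` of the game up to step `k`. -/
abbrev History (n k : ℕ) : Type := (i : Finset.Iic k) → Round n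

namespace History

variable {n k : ℕ}

/-- The most recent state of a history. -/
def last (h : History n k) : Round n := h ⟨k, Finset.mem_Iic.2 le_rfl⟩

/-- The current point `x_k`. -/
def position (h : History n k) : EuclideanSpace ℝ (Fin n) := h.last.2

theorem measurable_last : Measurable (last : History n k → Round n) := measurable_pi_apply _

theorem measurable_position :
    Measurable (position : History n k → EuclideanSpace ℝ (Fin n)) :=
  measurable_snd.comp measurable_last

end History

/-- A strategy with step size `ε`: Borel functions which give the next point, in the open ball
`B_ε(x_k)`, from the history of the game up to step `k`. -/
structure Strategy (n : ℕ) (ε : ℝ) where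
  move : (k : ℕ) → History n k → EuclideanSpace ℝ (Fin n)
  measurable_move : ∀ k, Measurable (move k)
  move_mem : ∀ k h, move k h ∈ Metric.ball (History.position h) ε

/-- The information which strategies may use: the current point only (with one and the same
rule in all rounds, or with a rule that may depend on the number of the round), the full history
of points, or the full history of points and coin tosses. -/
inductive Information
  | currentPoint
  | currentPointAndRound
  | points
  | pointsAndCoins

/-- The strategy `S` uses only the information `a`. -/
def Information.Allows {n : ℕ} {ε : ℝ} : Information → Strategy n ε → Prop
  | .currentPoint, S =>
      ∀ (k l : ℕ) (h : History n k) (h' : History n l),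
        h.position = h'.position → S.move k h = S.move l h'
  | .currentPointAndRound, S =>
      ∀ (k : ℕ) (h h' : History n k), h.position = h'.position → S.move k h = S.move k h'
  | .points, S =>
      ∀ (k : ℕ) (h h' : History n k), (∀ i, (h i).2 = (h' i).2) → S.move k h = S.move k h'
  | .pointsAndCoins, _ => True

/-- The data of the modified tug-of-war game with noise: a bounded domain `Ω` of `ℝⁿ`, the step
size `ε > 0`, the probabilities `α, β > 0` of a tug-of-war step and of a random step, and the
payoff function `F`, continuous on the two-sided boundary strip `{x | dist (x, ∂Ω) ≤ ε}`
(the values of `F` outside that strip play no role). -/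
structure TugOfWar (n : ℕ) where
  Ω : Set (EuclideanSpace ℝ (Fin n))
  isOpen_Ω : IsOpen Ω
  isConnected_Ω : IsConnected Ω
  isBounded_Ω : Bornology.IsBounded Ω
  ε : ℝ
  ε_pos : 0 < ε
  α : ℝ
  β : ℝ
  α_pos : 0 < α
  β_pos : 0 < β
  α_add_β : α + β = 1
  F : EuclideanSpace ℝ (Fin n) → ℝ
  continuousOn_F : ContinuousOn F {x | Metric.infDist x (frontier Ω) ≤ ε}

namespace TugOfWar

variable {n : ℕ} (G : TugOfWar n)

/-- The outer boundary strip `Γ_ε`. -/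
def outerStrip : Set (EuclideanSpace ℝ (Fin n)) := {x | x ∉ G.Ω ∧ Metric.infDist x G.Ω ≤ G.ε}

/-- The enlarged domain `Ω_ε = Γ_ε ∪ Ω`. -/
def extendedDomain : Set (EuclideanSpace ℝ (Fin n)) := G.outerStrip ∪ G.Ω

/-- The two-sided boundary strip `Γ_{ε,ε}`. -/
def strip : Set (EuclideanSpace ℝ (Fin n)) := {x | Metric.infDist x (frontier G.Ω) ≤ G.ε}

/-- The payoff function `F` on `Γ_{ε,ε}`, extended by zero. -/
def stripPayoff : EuclideanSpace ℝ (Fin n) → ℝ := G.strip.indicator G.F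

/-- The probability `δ(x)` that the extra coin stops the game at `x`. -/
def stopProb : EuclideanSpace ℝ (Fin n) → ℝ :=
  G.strip.indicator fun x => 1 - G.ε⁻¹ * Metric.infDist x G.outerStrip

/-- The dynamic programming principle of the modified game, for a function `u` on `Ω_ε`
(only the values of `u` on `Ω_ε` matter: where `B_ε(x)` is not contained in `Ω_ε`,
the factor `1 - δ(x)` is zero). -/
def SolvesDPP (u : EuclideanSpace ℝ (Fin n) → ℝ) : Prop :=
  ∀ x ∈ G.extendedDomain,
    u x = (1 - G.stopProb x) *
        (G.α / 2 * sSup (u '' Metric.ball x G.ε) + G.α / 2 * sInf (u '' Metric.ball x G.ε)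
          + G.β * ⨍ y in Metric.ball x G.ε, u y)
      + G.stopProb x * G.stripPayoff x

theorem isClosed_strip : IsClosed G.strip :=
  isClosed_le (Metric.continuous_infDist_pt _) continuous_const

theorem measurable_stopProb : Measurable G.stopProb := by
  refine Measurable.indicator ?_ G.isClosed_strip.measurableSet
  exact (continuous_const.sub (continuous_const.mul
    (Metric.continuous_infDist_pt _))).measurable

theorem stopProb_le_one (x : EuclideanSpace ℝ (Fin n)) : G.stopProb x ≤ 1 := by
  unfold stopProb
  by_cases hx : x ∈ G.strip
  · rw [indicator_of_mem hx]
    have := mul_nonneg (inv_nonneg.2 G.ε_pos.le)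
      (Metric.infDist_nonneg (x := x) (s := G.outerStrip))
    linarith
  · rw [indicator_of_notMem hx]
    exact zero_le_one

theorem stopProb_nonneg (x : EuclideanSpace ℝ (Fin n)) : 0 ≤ G.stopProb x := by
  unfold stopProb
  by_cases hx : x ∈ G.strip
  · rw [indicator_of_mem hx]
    suffices h : Metric.infDist x G.outerStrip ≤ G.ε by
      have h1 := mul_le_mul_of_nonneg_left h (inv_nonneg.2 G.ε_pos.le)
      rw [inv_mul_cancel₀ G.ε_pos.ne'] at h1
      linarith
    rcases (frontier G.Ω).eq_empty_or_nonempty with he | hne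
    · have hu : G.Ω = univ :=
        (isClopen_iff_frontier_eq_empty.2 he).eq_univ G.isConnected_Ω.nonempty
      have h0 : G.outerStrip = ∅ := by
        ext y
        simp [outerStrip, hu]
      rw [h0, Metric.infDist_empty]
      exact G.ε_pos.le
    · refine (Metric.infDist_le_infDist_of_subset ?_ hne).trans hx
      intro y hy
      refine ⟨?_, ?_⟩
      · have := hy.2
        rwa [G.isOpen_Ω.interior_eq] at this
      · rw [← Metric.infDist_closure, Metric.infDist_zero_of_mem (frontier_subset_closure hy)]
        exact G.ε_pos.le
  · rw [indicator_of_notMem hx]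

/-- The uniform probability distribution on `B_ε(x)`. -/
def uniform (x : EuclideanSpace ℝ (Fin n)) : Measure (EuclideanSpace ℝ (Fin n)) :=
  ProbabilityTheory.cond volume (Metric.ball x G.ε)

instance isProbabilityMeasure_uniform (x : EuclideanSpace ℝ (Fin n)) :
    IsProbabilityMeasure (G.uniform x) :=
  cond_isProbabilityMeasure_of_finite (Metric.measure_ball_pos volume x G.ε_pos).ne'
    Metric.isBounded_ball.measure_lt_top.ne

theorem measurable_uniform : Measurable G.uniform := by
  refine Measure.measurable_of_measurable_coe _ fun s hs => ?_
  have key : ∀ t : Set (EuclideanSpace ℝ (Fin n)), MeasurableSet t →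
      Measurable fun x => (volume : Measure (EuclideanSpace ℝ (Fin n)))
        (Metric.ball x G.ε ∩ t) := by
    intro t ht
    have hm : MeasurableSet
        {p : EuclideanSpace ℝ (Fin n) × EuclideanSpace ℝ (Fin n) | dist p.2 p.1 < G.ε ∧ p.2 ∈ t} :=
      (measurableSet_lt (measurable_snd.dist measurable_fst) measurable_const).inter
        (measurable_snd ht)
    exact measurable_measure_prodMk_left hm
  have h2 : Measurable fun x => (volume : Measure (EuclideanSpace ℝ (Fin n)))
      (Metric.ball x G.ε) := by
    simpa using key univ MeasurableSet.univ
  have h3 : (fun x => G.uniform x s) = fun x =>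
      (volume (Metric.ball x G.ε))⁻¹ * volume (Metric.ball x G.ε ∩ s) := by
    funext x
    exact cond_apply Metric.isOpen_ball.measurableSet _ _
  rw [h3]
  exact h2.inv.mul (key s hs)

/-- The law of the next state when the token is at `x`, Player I wants to move it to `y` and
Player II wants to move it to `z`: with probability `δ(x)` the game is stopped at `x`; otherwise
Player I and Player II each win the round with probability `α / 2`, and a uniformly distributed
random step in `B_ε(x)` takes place with probability `β`. -/
def roundLaw (x y z : EuclideanSpace ℝ (Fin n)) : Measure (Round n) :=
  ENNReal.ofReal (G.stopProb x) • Measure.dirac (Outcome.stopped, x)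
    + ENNReal.ofReal (1 - G.stopProb x) •
      (ENNReal.ofReal (G.α / 2) • Measure.dirac (Outcome.playerI, y)
        + ENNReal.ofReal (G.α / 2) • Measure.dirac (Outcome.playerII, z)
        + ENNReal.ofReal G.β • (G.uniform x).map (Prod.mk Outcome.noise))

instance isProbabilityMeasure_roundLaw (x y z : EuclideanSpace ℝ (Fin n)) :
    IsProbabilityMeasure (G.roundLaw x y z) := by
  have hu : IsProbabilityMeasure ((G.uniform x).map (Prod.mk Outcome.noise)) :=
    Measure.isProbabilityMeasure_map measurable_prodMk_left.aemeasurable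
  refine ⟨?_⟩
  have hα := G.α_pos.le
  have hβ := G.β_pos.le
  have h0 := G.stopProb_nonneg x
  have h1 := G.stopProb_le_one x
  simp only [roundLaw, Measure.add_apply, Measure.smul_apply, measure_univ, smul_eq_mul, mul_one]
  rw [← ENNReal.ofReal_add (by linarith) (by linarith), ← ENNReal.ofReal_add (by linarith) hβ,
    add_halves, G.α_add_β, ENNReal.ofReal_one, mul_one, ← ENNReal.ofReal_add h0 (by linarith)]
  simp

theorem measurable_roundLaw {H : Type*} [MeasurableSpace H]
    {a b c : H → EuclideanSpace ℝ (Fin n)} (ha : Measurable a) (hb : Measurable b)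
    (hc : Measurable c) : Measurable fun h => G.roundLaw (a h) (b h) (c h) := by
  refine Measure.measurable_of_measurable_coe _ fun s hs => ?_
  have hd : ∀ (o : Outcome) (f : H → EuclideanSpace ℝ (Fin n)), Measurable f →
      Measurable fun h => Measure.dirac (o, f h) s := fun o f hf =>
    (Measure.measurable_coe hs).comp
      (Measure.measurable_dirac.comp (measurable_const.prodMk hf))
  have hu : Measurable fun h => ((G.uniform (a h)).map (Prod.mk Outcome.noise)) s :=
    (Measure.measurable_coe hs).comp
      ((Measure.measurable_map _ measurable_prodMk_left).comp (G.measurable_uniform.comp ha))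
  have hδ : Measurable fun h => G.stopProb (a h) := G.measurable_stopProb.comp ha
  simp only [roundLaw, Measure.add_apply, Measure.smul_apply, smul_eq_mul]
  exact (hδ.ennreal_ofReal.mul (hd _ _ ha)).add
    ((measurable_const.sub hδ).ennreal_ofReal.mul
      (((measurable_const.mul (hd _ _ hb)).add (measurable_const.mul (hd _ _ hc))).add
        (measurable_const.mul hu)))

open Classical in
/-- The law of the next state given the history `h`, when the players use the strategies `S` and
`T`.  Once the game has been stopped, nothing changes any more. -/
def nextLaw (S T : Strategy n G.ε) (k : ℕ) (h : History n k) : Measure (Round n) :=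
  if h.last.1 = Outcome.stopped then Measure.dirac h.last
  else G.roundLaw h.position (S.move k h) (T.move k h)

theorem measurable_nextLaw (S T : Strategy n G.ε) (k : ℕ) : Measurable (G.nextLaw S T k) := by
  have hc : Measurable fun h : History n k => h.last.1 :=
    measurable_fst.comp History.measurable_last
  have hs : MeasurableSet {h : History n k | h.last.1 = Outcome.stopped} :=
    hc (show MeasurableSet {Outcome.stopped} from trivial)
  have h1 : Measurable fun h : History n k => Measure.dirac h.last :=
    Measure.measurable_dirac.comp History.measurable_last
  have h2 : Measurable fun h : History n k =>
      G.roundLaw h.position (S.move k h) (T.move k h) :=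
    G.measurable_roundLaw History.measurable_position (S.measurable_move k) (T.measurable_move k)
  unfold nextLaw
  exact Measurable.ite hs h1 h2

/-- The transition kernel from histories up to step `k` to the state at step `k + 1`. -/
def step (S T : Strategy n G.ε) (k : ℕ) : Kernel (History n k) (Round n) where
  toFun := G.nextLaw S T k
  measurable' := G.measurable_nextLaw S T k

instance isMarkovKernel_step (S T : Strategy n G.ε) (k : ℕ) : IsMarkovKernel (G.step S T k) := by
  refine ⟨fun h => ?_⟩
  change IsProbabilityMeasure (G.nextLaw S T k h)
  unfold nextLaw
  split_ifs <;> infer_instance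

/-- The law `ℙ^{x₀}_{S,T}` of the whole game with starting point `x₀`, when Player I uses `S` and
Player II uses `T`. -/
def gameLaw (S T : Strategy n G.ε) (x₀ : EuclideanSpace ℝ (Fin n)) : Measure (ℕ → Round n) :=
  Kernel.traj (X := fun _ => Round n) (G.step S T) 0 (fun _ => (Outcome.start, x₀))

/-- The payoff `F(x_τ)` of a run of the game, where `τ` is the step at which it is stopped
(runs which are never stopped form a null event, on which the value does not matter). -/
def payoff (ω : ℕ → Round n) : ℝ :=
  G.stripPayoff (ω (sInf {k | (ω k).1 = Outcome.stopped})).2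

/-- The expected payoff `𝔼^{x₀}_{S,T}[F(x_τ)]`. -/
def expectedPayoff (S T : Strategy n G.ε) (x₀ : EuclideanSpace ℝ (Fin n)) : ℝ :=
  ∫ ω, G.payoff ω ∂(G.gameLaw S T x₀)

/-- The value of the game for Player I, when strategies may use the information `a`. -/
def valueI (a : Information) (x₀ : EuclideanSpace ℝ (Fin n)) : ℝ :=
  ⨆ S : {S : Strategy n G.ε // a.Allows S}, ⨅ T : {T : Strategy n G.ε // a.Allows T},
    G.expectedPayoff S.1 T.1 x₀

/-- The value of the game for Player II, when strategies may use the information `a`. -/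
def valueII (a : Information) (x₀ : EuclideanSpace ℝ (Fin n)) : ℝ :=
  ⨅ T : {T : Strategy n G.ε // a.Allows T}, ⨆ S : {S : Strategy n G.ε // a.Allows S},
    G.expectedPayoff S.1 T.1 x₀

end TugOfWar

end

/-! Everything rests on one Lyapunov function (`exists_lyapunov`): a continuous `V` with `1 ≤ V ≤ A`
and `α A + β ⨍ V ≤ V - 1` on `Ω`. Since `V ≤ A` at whatever points the players choose, `V` drops by
at least one in expectation per unstopped round, and the noise alone causes this.

This inequality is used three times. In the DPP it makes the operator a contraction with factor `1 -
A⁻¹` in the norm weighted by `V`, so Banach's theorem gives a continuous solution. In the game it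
makes the probability of not having stopped decay geometrically. For strategies, if a player picks
points that are optimal for `u` up to `η`, then `u + η V` is a supermartingale against every
opponent, because the error `η` of each round is paid by the drop of `η V`. The total error is thus
at most `η V x₀`, uniformly over the opponent's strategies (`integral_stopped_le_add`).

Near-optimal points can be selected as a Borel function of the current point. Such strategies are
allowed under every information alternative and work against opponents with full history, so all
alternatives have the value `u`. The argument applies to any continuous solution of the DPP, so each
of them equals the value, and uniqueness follows.

All functions are extended continuously to the whole space. This is harmless: where a ball could
leave `Ω_ε`, the factor `1 - δ` vanishes. -/

open scoped Topology BoundedContinuousFunction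

noncomputable section

namespace TugOfWar

variable {n : ℕ} (G : TugOfWar n)

/-! ### Geometry of the boundary strips and continuous extension of the data -/

section Geometry

theorem mem_extendedDomain_iff {x : EuclideanSpace ℝ (Fin n)} :
    x ∈ G.extendedDomain ↔ Metric.infDist x G.Ω ≤ G.ε := by
  constructor
  · rintro (hx | hx)
    · exact hx.2
    · rw [Metric.infDist_zero_of_mem hx]
      exact G.ε_pos.le
  · intro hx
    by_cases h : x ∈ G.Ω
    · exact Or.inr h
    · exact Or.inl ⟨h, hx⟩

theorem isClosed_extendedDomain : IsClosed G.extendedDomain := by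
  have : G.extendedDomain = {x | Metric.infDist x G.Ω ≤ G.ε} :=
    Set.ext fun x => G.mem_extendedDomain_iff
  rw [this]
  exact isClosed_le (Metric.continuous_infDist_pt _) continuous_const

theorem isCompact_extendedDomain : IsCompact G.extendedDomain := by
  refine Metric.isCompact_of_isClosed_isBounded G.isClosed_extendedDomain ?_
  refine (G.isBounded_Ω.thickening (δ := G.ε + 1)).subset fun x hx => ?_
  rw [Metric.mem_thickening_iff_infDist_lt G.isConnected_Ω.nonempty]
  have := G.mem_extendedDomain_iff.1 hx
  linarith

theorem ball_subset_extendedDomain {x : EuclideanSpace ℝ (Fin n)} (hx : x ∈ G.Ω) :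
    Metric.ball x G.ε ⊆ G.extendedDomain := fun _ hy =>
  G.mem_extendedDomain_iff.2
    ((Metric.infDist_le_dist_of_mem hx).trans (Metric.mem_ball.1 hy).le)

theorem Ω_ne_univ (hn : 0 < n) : G.Ω ≠ univ := by
  have : Nonempty (Fin n) := ⟨⟨0, hn⟩⟩
  intro hu
  exact NormedSpace.unbounded_univ ℝ (EuclideanSpace ℝ (Fin n)) (hu ▸ G.isBounded_Ω)

theorem strip_subset_extendedDomain (hn : 0 < n) : G.strip ⊆ G.extendedDomain := by
  intro x hx
  rw [mem_extendedDomain_iff]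
  -- Positive dimension enters here: `infDist` to an empty frontier would be `0` by default, and the
  -- strip would be the whole space.
  have hne : (frontier G.Ω).Nonempty := nonempty_iff_ne_empty.2 fun he => G.Ω_ne_univ hn
    ((isClopen_iff_frontier_eq_empty.2 he).eq_univ G.isConnected_Ω.nonempty)
  rw [← Metric.infDist_closure]
  exact (Metric.infDist_le_infDist_of_subset frontier_subset_closure hne).trans hx

theorem isCompact_strip (hn : 0 < n) : IsCompact G.strip :=
  G.isCompact_extendedDomain.of_isClosed_subset G.isClosed_strip (G.strip_subset_extendedDomain hn)

/-- A continuous extension of the stopping probability to the whole space. -/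
def extendedStopProb (x : EuclideanSpace ℝ (Fin n)) : ℝ :=
  max 0 (1 - G.ε⁻¹ * Metric.infDist x G.Ωᶜ)

theorem continuous_extendedStopProb : Continuous G.extendedStopProb :=
  continuous_const.max (continuous_const.sub (continuous_const.mul
    (Metric.continuous_infDist_pt _)))

theorem extendedStopProb_nonneg (x : EuclideanSpace ℝ (Fin n)) : 0 ≤ G.extendedStopProb x :=
  le_max_left _ _

theorem extendedStopProb_le_one (x : EuclideanSpace ℝ (Fin n)) : G.extendedStopProb x ≤ 1 := by
  refine max_le zero_le_one ?_
  have := mul_nonneg (inv_nonneg.2 G.ε_pos.le) (Metric.infDist_nonneg (x := x) (s := G.Ωᶜ))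
  linarith

theorem extendedStopProb_of_notMem {x : EuclideanSpace ℝ (Fin n)} (hx : x ∉ G.Ω) :
    G.extendedStopProb x = 1 := by
  simp [extendedStopProb, Metric.infDist_zero_of_mem (show x ∈ G.Ωᶜ from hx)]

theorem frontier_subset_outerStrip : frontier G.Ω ⊆ G.outerStrip := by
  intro y hy
  refine ⟨?_, ?_⟩
  · have := hy.2
    rwa [G.isOpen_Ω.interior_eq] at this
  · rw [← Metric.infDist_closure, Metric.infDist_zero_of_mem (frontier_subset_closure hy)]
    exact G.ε_pos.le

/-- A point of `Ωᶜ` nearest to `x ∈ Ω` lies on the frontier, and `∂Ω ⊆ Γ_ε ⊆ Ωᶜ`. This replaces the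
distances in `δ` by the single distance to `Ωᶜ`, from which the globally continuous form of `δ` is
built. -/
theorem infDist_eq_of_mem (hn : 0 < n) {x : EuclideanSpace ℝ (Fin n)} (hx : x ∈ G.Ω) :
    Metric.infDist x (frontier G.Ω) = Metric.infDist x G.Ωᶜ ∧
      Metric.infDist x G.outerStrip = Metric.infDist x G.Ωᶜ := by
  obtain ⟨y, hy, hxy⟩ := exists_mem_frontier_infDist_compl_eq_dist hx (G.Ω_ne_univ hn)
  have h1 : Metric.infDist x (frontier G.Ω) ≤ Metric.infDist x G.Ωᶜ :=
    hxy ▸ Metric.infDist_le_dist_of_mem hy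
  have h2 : Metric.infDist x G.outerStrip ≤ Metric.infDist x (frontier G.Ω) :=
    Metric.infDist_le_infDist_of_subset G.frontier_subset_outerStrip ⟨y, hy⟩
  have h3 : Metric.infDist x G.Ωᶜ ≤ Metric.infDist x G.outerStrip :=
    Metric.infDist_le_infDist_of_subset (fun z hz => hz.1) ⟨y, G.frontier_subset_outerStrip hy⟩
  constructor <;> linarith

theorem outerStrip_subset_strip : G.outerStrip ⊆ G.strip := by
  intro x hx
  obtain ⟨y, hy, hxy⟩ := exists_mem_frontier_infDist_compl_eq_dist (s := G.Ωᶜ) hx.1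
    (by simpa using G.isConnected_Ω.nonempty.ne_empty)
  rw [frontier_compl] at hy
  rw [compl_compl] at hxy
  exact (Metric.infDist_le_dist_of_mem hy).trans (hxy ▸ hx.2)

theorem stopProb_eq_extendedStopProb (hn : 0 < n) {x : EuclideanSpace ℝ (Fin n)}
    (hx : x ∈ G.extendedDomain) : G.stopProb x = G.extendedStopProb x := by
  by_cases h : x ∈ G.Ω
  · obtain ⟨h1, h2⟩ := G.infDist_eq_of_mem hn h
    unfold stopProb extendedStopProb
    by_cases hs : x ∈ G.strip
    · rw [indicator_of_mem hs, h2, max_eq_right]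
      have hs' : Metric.infDist x (frontier G.Ω) ≤ G.ε := hs
      rw [h1] at hs'
      have := mul_le_mul_of_nonneg_left hs' (inv_nonneg.2 G.ε_pos.le)
      rw [inv_mul_cancel₀ G.ε_pos.ne'] at this
      linarith
    · rw [indicator_of_notMem hs, max_eq_left]
      have hs' : ¬ Metric.infDist x (frontier G.Ω) ≤ G.ε := hs
      rw [h1, not_le] at hs'
      have := mul_le_mul_of_nonneg_left hs'.le (inv_nonneg.2 G.ε_pos.le)
      rw [inv_mul_cancel₀ G.ε_pos.ne'] at this
      linarith
  · have ho : x ∈ G.outerStrip := hx.resolve_right h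
    rw [G.extendedStopProb_of_notMem h, stopProb, indicator_of_mem (G.outerStrip_subset_strip ho),
      Metric.infDist_zero_of_mem ho]
    simp

theorem stopProb_eq_one (hn : 0 < n) {x : EuclideanSpace ℝ (Fin n)}
    (hx : x ∈ G.extendedDomain) (h : x ∉ G.Ω) : G.stopProb x = 1 := by
  rw [G.stopProb_eq_extendedStopProb hn hx, G.extendedStopProb_of_notMem h]

theorem stopProb_of_notMem_strip {x : EuclideanSpace ℝ (Fin n)} (hx : x ∉ G.strip) :
    G.stopProb x = 0 := indicator_of_notMem hx _

/-- Tietze extension, with boundedness from compactness. It moves the payoff, and later any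
competing solution of the DPP, into the Banach space of bounded continuous functions. -/
theorem _root_.IsCompact.exists_boundedContinuousFunction_eqOn {X : Type*} [TopologicalSpace X]
    [NormalSpace X] [T2Space X] {s : Set X} (hs : IsCompact s) {f : X → ℝ}
    (hf : ContinuousOn f s) : ∃ g : X →ᵇ ℝ, EqOn g f s := by
  have : CompactSpace s := isCompact_iff_compactSpace.1 hs
  obtain ⟨g, -, hg⟩ := BoundedContinuousFunction.exists_norm_eq_domRestrict_eq_of_closed
    (BoundedContinuousFunction.mkOfCompact ⟨s.domRestrict f, hf.domRestrict⟩) hs.isClosed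
  refine ⟨g, fun x hx => ?_⟩
  exact DFunLike.congr_fun hg ⟨x, hx⟩

theorem exists_stripPayoff_eq (hn : 0 < n) : ∃ f : EuclideanSpace ℝ (Fin n) →ᵇ ℝ,
    G.stripPayoff = G.strip.indicator f := by
  obtain ⟨f, hf⟩ := (G.isCompact_strip hn).exists_boundedContinuousFunction_eqOn G.continuousOn_F
  exact ⟨f, indicator_congr hf.symm⟩

theorem measurable_stripPayoff (hn : 0 < n) : Measurable G.stripPayoff := by
  obtain ⟨f, hf⟩ := G.exists_stripPayoff_eq hn
  rw [hf]
  exact f.continuous.measurable.indicator G.isClosed_strip.measurableSet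

theorem exists_abs_stripPayoff_le (hn : 0 < n) : ∃ C, ∀ x, |G.stripPayoff x| ≤ C := by
  obtain ⟨f, hf⟩ := G.exists_stripPayoff_eq hn
  refine ⟨‖f‖, fun x => ?_⟩
  rw [hf, ← Real.norm_eq_abs]
  exact (norm_indicator_le_norm_self _ _).trans (f.norm_coe_le_norm x)

end Geometry

/-! ### The Lyapunov function -/

section Lyapunov

theorem integral_uniform (f : EuclideanSpace ℝ (Fin n) → ℝ) (x : EuclideanSpace ℝ (Fin n)) :
    ∫ y, f y ∂(G.uniform x) = ⨍ y in Metric.ball x G.ε, f y := by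
  rw [average_eq', Measure.restrict_apply_univ]
  rfl

theorem ae_mem_ball_uniform (x : EuclideanSpace ℝ (Fin n)) :
    ∀ᵐ y ∂(G.uniform x), y ∈ Metric.ball x G.ε :=
  ae_cond_mem measurableSet_ball

/-- By translation invariance, the noise has a fixed chance `p`, the same at every `x`, of landing
in a small ball where the first coordinate has grown by at least `ε / 2`. -/
theorem exists_uniform_real_ball_eq (hn : 0 < n) : ∃ p : ℝ, 0 < p ∧
    ∀ x : EuclideanSpace ℝ (Fin n), (G.uniform x).real
      (Metric.ball (x + EuclideanSpace.single (⟨0, hn⟩ : Fin n) (3 / 4 * G.ε)) (G.ε / 4)) = p ∧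
      Metric.ball (x + EuclideanSpace.single (⟨0, hn⟩ : Fin n) (3 / 4 * G.ε)) (G.ε / 4) ⊆
        Metric.ball x G.ε := by
  have hε := G.ε_pos
  refine ⟨((volume : Measure (EuclideanSpace ℝ (Fin n))).real (Metric.ball 0 G.ε))⁻¹ *
    (volume : Measure (EuclideanSpace ℝ (Fin n))).real (Metric.ball 0 (G.ε / 4)), ?_, ?_⟩
  · have h : ∀ r : ℝ, 0 < r →
        0 < (volume : Measure (EuclideanSpace ℝ (Fin n))).real (Metric.ball 0 r) := fun r hr =>
      ENNReal.toReal_pos (Metric.measure_ball_pos volume _ hr).ne'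
        Metric.isBounded_ball.measure_lt_top.ne
    exact mul_pos (inv_pos.2 (h _ hε)) (h _ (by linarith))
  · intro x
    have hsub : Metric.ball (x + EuclideanSpace.single (⟨0, hn⟩ : Fin n) (3 / 4 * G.ε)) (G.ε / 4) ⊆
        Metric.ball x G.ε := by
      refine Metric.ball_subset_ball' ?_
      rw [dist_self_add_left, PiLp.norm_single, Real.norm_of_nonneg (by linarith)]
      linarith
    refine ⟨?_, hsub⟩
    rw [measureReal_def, uniform, cond_apply measurableSet_ball, inter_eq_right.2 hsub,
      ENNReal.toReal_mul, ENNReal.toReal_inv, Measure.addHaar_ball_center volume x,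
      Measure.addHaar_ball_center volume (x + _)]
    rfl

/-- A bounded function which decreases by at least one in expectation, whatever the players do. -/
theorem exists_lyapunov (hn : 0 < n) : ∃ (V : EuclideanSpace ℝ (Fin n) → ℝ) (A : ℝ),
    Continuous V ∧ (∀ x, 1 ≤ V x) ∧ (∀ x, V x ≤ A) ∧
      ∀ x ∈ G.Ω, G.α * A + G.β * ∫ y, V y ∂(G.uniform x) ≤ V x - 1 := by
  have hε := G.ε_pos
  have hβ := G.β_pos
  obtain ⟨p, hp, hball⟩ := G.exists_uniform_real_ball_eq hn
  obtain ⟨R, hR0, hR⟩ := G.isCompact_extendedDomain.isBounded.exists_pos_norm_le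
  set i₀ : Fin n := ⟨0, hn⟩
  obtain ⟨l, hl, hle⟩ : ∃ l : ℝ, 0 ≤ l ∧ 2 ≤ G.β * (p * Real.exp (l * (G.ε / 2))) := by
    -- With this `l` the exponent is `t = 2 / (β p)`, and `exp t ≥ t + 1` gives `β p exp t ≥ 2`.
    refine ⟨2 / (G.β * p) * (2 / G.ε), by positivity, ?_⟩
    have h1 : 2 / (G.β * p) * (2 / G.ε) * (G.ε / 2) = 2 / (G.β * p) := by field_simp
    rw [h1]
    have h2 := Real.add_one_le_exp (2 / (G.β * p))
    have h3 : 2 / (G.β * p) * (G.β * p) = 2 := by field_simp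
    nlinarith [mul_pos hβ hp]
  -- An exponential in the first coordinate. The truncation at `±R` makes it bounded on the whole
  -- space and changes nothing on `Ω_ε`.
  set ψ : EuclideanSpace ℝ (Fin n) → ℝ :=
    fun y => Real.exp (l * max (-R) (min (y i₀) R)) with hψ
  have hcont : Continuous ψ := by fun_prop
  have hψle : ∀ y, ψ y ≤ Real.exp (l * R) := fun y => Real.exp_le_exp.2
    (mul_le_mul_of_nonneg_left (max_le (by linarith) (min_le_right _ _)) hl)
  have hψge : ∀ y, Real.exp (-(l * R)) ≤ ψ y := fun y => Real.exp_le_exp.2 (by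
    have := mul_le_mul_of_nonneg_left (le_max_left (-R) (min (y i₀) R)) hl
    linarith)
  have hψK : ∀ y ∈ G.extendedDomain, ψ y = Real.exp (l * y i₀) := by
    intro y hy
    have h := abs_le.1 ((Real.norm_eq_abs _ ▸ PiLp.norm_apply_le y i₀).trans (hR y hy))
    simp only [hψ]
    rw [min_eq_left h.2, max_eq_right h.1]
  have hint : ∀ x, Integrable ψ (G.uniform x) := fun x =>
    Integrable.of_bound hcont.aestronglyMeasurable (Real.exp (l * R))
      (ae_of_all _ fun y => by
        rw [Real.norm_of_nonneg (Real.exp_pos _).le]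
        exact hψle y)
  -- As `ψ` is positive, the average may be restricted to the small ball, where `ψ ≥ exp (l ε / 2) ψ
  -- x`.
  have hkey : ∀ x ∈ G.Ω, 2 * ψ x ≤ G.β * ∫ y, ψ y ∂(G.uniform x) := by
    intro x hx
    obtain ⟨hpx, hsub⟩ := hball x
    set B := Metric.ball (x + EuclideanSpace.single i₀ (3 / 4 * G.ε)) (G.ε / 4) with hB
    have h1 : p * Real.exp (l * (x i₀ + G.ε / 2)) ≤ ∫ y, ψ y ∂(G.uniform x) := by
      rw [← hpx, ← smul_eq_mul, ← integral_indicator_const _ measurableSet_ball]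
      refine integral_mono ((integrable_const _).indicator measurableSet_ball) (hint x) ?_
      intro y
      by_cases hy : y ∈ B
      · rw [indicator_of_mem hy, hψK y (G.ball_subset_extendedDomain hx (hsub hy))]
        refine Real.exp_le_exp.2 (mul_le_mul_of_nonneg_left ?_ hl)
        have h2 := (Real.norm_eq_abs _ ▸ PiLp.norm_apply_le
          (y - (x + EuclideanSpace.single i₀ (3 / 4 * G.ε))) i₀).trans
            (mem_ball_iff_norm.1 hy).le
        simp only [PiLp.sub_apply, PiLp.add_apply, PiLp.single_apply, if_true] at h2
        have := (abs_le.1 h2).1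
        linarith
      · rw [indicator_of_notMem hy]
        exact (Real.exp_pos _).le
    have h2 : Real.exp (l * (x i₀ + G.ε / 2)) = Real.exp (l * (G.ε / 2)) * ψ x := by
      rw [hψK x (Or.inr hx), ← Real.exp_add]
      congr 1
      ring
    rw [h2] at h1
    calc 2 * ψ x ≤ G.β * (p * Real.exp (l * (G.ε / 2))) * ψ x :=
          mul_le_mul_of_nonneg_right hle (Real.exp_pos _).le
      _ = G.β * (p * (Real.exp (l * (G.ε / 2)) * ψ x)) := by ring
      _ ≤ _ := mul_le_mul_of_nonneg_left h1 hβ.le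
  set c := Real.exp (l * R) with hc
  have hc1 : 1 ≤ c := Real.one_le_exp (by positivity)
  have hcc : Real.exp (-(l * R)) = c⁻¹ := Real.exp_neg _
  have hc0 : c * c⁻¹ = 1 := mul_inv_cancel₀ (by positivity)
  -- The bounds `c⁻¹ ≤ ψ ≤ c` hold. With `V = c (c + 1 - ψ)` and `A = c (c + 1)`, the left side is
  -- `A - c β ∫ ψ ≤ A - 2 c ψ x`, and the right side is `A - c ψ x - 1`; the gap is covered by `c ψ
  -- x ≥ 1`.
  refine ⟨fun x => c * (c + 1 - ψ x), c * (c + 1), by fun_prop, fun x => ?_, fun x => ?_,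
    fun x hx => ?_⟩
  · nlinarith [hψle x]
  · have := Real.exp_pos (l * max (-R) (min (x i₀) R))
    exact mul_le_mul_of_nonneg_left (by linarith [hψge x, Real.exp_pos (-(l * R))]) (by linarith)
  · rw [integral_const_mul, integral_sub (integrable_const _) (hint x), integral_const,
      probReal_univ, one_smul]
    have h1 := hkey x hx
    have h2 := hψge x
    rw [hcc] at h2
    have h3 : G.α = 1 - G.β := by linarith [G.α_add_β]
    have h4 : c * (2 * ψ x) ≤ c * (G.β * ∫ y, ψ y ∂(G.uniform x)) :=
      mul_le_mul_of_nonneg_left h1 (by linarith)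
    have h5 := mul_le_mul_of_nonneg_left h2 (show 0 ≤ c by linarith)
    rw [hc0] at h5
    rw [h3]
    nlinarith

end Lyapunov

/-! ### Existence for the dynamic programming principle -/

section DynamicProgramming

/-- The expected value of `u` after a round which starts at `x`, is not stopped, and is played
optimally by both players. -/
def mean (u : EuclideanSpace ℝ (Fin n) → ℝ) (x : EuclideanSpace ℝ (Fin n)) : ℝ :=
  G.α / 2 * sSup (u '' Metric.ball x G.ε) + G.α / 2 * sInf (u '' Metric.ball x G.ε)
    + G.β * ⨍ y in Metric.ball x G.ε, u y

/-- By continuity the supremum is unchanged on the closed ball. After translation the set is compact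
and independent of `x`, so the supremum depends continuously on `x`. -/
theorem sSup_image_ball_eq {u : EuclideanSpace ℝ (Fin n) → ℝ} (hu : Continuous u)
    (x : EuclideanSpace ℝ (Fin n)) {r : ℝ} (hr : 0 < r) :
    sSup (u '' Metric.ball x r) = sSup ((fun h => u (x + h)) '' Metric.closedBall 0 r) := by
  have hbdd : BddAbove ((fun h => u (x + h)) '' Metric.closedBall 0 r) :=
    (isCompact_closedBall 0 r).bddAbove_image (by fun_prop)
  have hsub : u '' Metric.ball x r ⊆ (fun h => u (x + h)) '' Metric.closedBall 0 r := by
    rintro _ ⟨y, hy, rfl⟩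
    exact ⟨y - x, by simpa [← dist_eq_norm] using (Metric.mem_ball.1 hy).le, by simp⟩
  refine le_antisymm (csSup_le_csSup hbdd ((Metric.nonempty_ball.2 hr).image u) hsub)
    (csSup_le ((Metric.nonempty_closedBall.2 hr.le).image _) ?_)
  rintro _ ⟨h, hh, rfl⟩
  have hcl : closure (Metric.ball x r) ⊆ {y | u y ≤ sSup (u '' Metric.ball x r)} :=
    closure_minimal (fun y hy => le_csSup (hbdd.mono hsub) (mem_image_of_mem u hy))
      (isClosed_le hu continuous_const)
  rw [closure_ball x hr.ne'] at hcl
  exact hcl (by simpa using hh)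

theorem continuous_sSup_image_ball {u : EuclideanSpace ℝ (Fin n) → ℝ} (hu : Continuous u)
    {r : ℝ} (hr : 0 < r) : Continuous fun x => sSup (u '' Metric.ball x r) := by
  simp_rw [fun x => sSup_image_ball_eq hu x hr]
  exact (isCompact_closedBall 0 r).continuous_sSup (by fun_prop)

theorem sInf_image_eq_neg_sSup {X : Type*} (u : X → ℝ) (s : Set X) :
    sInf (u '' s) = -sSup ((fun y => -u y) '' s) := by
  rw [Real.sInf_def]
  congr 2
  ext t
  simp [neg_eq_iff_eq_neg]

theorem continuous_sInf_image_ball {u : EuclideanSpace ℝ (Fin n) → ℝ} (hu : Continuous u)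
    {r : ℝ} (hr : 0 < r) : Continuous fun x => sInf (u '' Metric.ball x r) := by
  simp_rw [sInf_image_eq_neg_sSup]
  exact (continuous_sSup_image_ball hu.neg hr).neg

theorem continuous_average_ball (u : EuclideanSpace ℝ (Fin n) →ᵇ ℝ) (r : ℝ) :
    Continuous fun x => ⨍ y in Metric.ball x r, u y := by
  have h : ∀ x, ⨍ y in Metric.ball x r, u y =
      ((volume : Measure (EuclideanSpace ℝ (Fin n))).real (Metric.ball 0 r))⁻¹ *
        ∫ y in Metric.ball 0 r, u (x + y) := by
    intro x
    rw [setAverage_eq, smul_eq_mul, measureReal_def, measureReal_def,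
      Measure.addHaar_ball_center volume x]
    congr 1
    rw [← (measurePreserving_add_left volume x).setIntegral_preimage_emb
      (measurableEmbedding_addLeft x)]
    congr 2
    ext y
    simp
  simp_rw [h]
  refine continuous_const.mul ?_
  refine continuous_of_dominated (bound := fun _ => ‖u‖) (fun x => ?_) (fun x => ?_) ?_ ?_
  · exact (u.continuous.comp (continuous_const.add continuous_id)).aestronglyMeasurable
  · exact ae_of_all _ fun y => u.norm_coe_le_norm _
  · exact integrableOn_const Metric.isBounded_ball.measure_lt_top.ne
  · exact ae_of_all _ fun y => by fun_prop

theorem continuous_mean (u : EuclideanSpace ℝ (Fin n) →ᵇ ℝ) : Continuous (G.mean u) :=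
  ((continuous_const.mul (continuous_sSup_image_ball u.continuous G.ε_pos)).add
    (continuous_const.mul (continuous_sInf_image_ball u.continuous G.ε_pos))).add
      (continuous_const.mul (continuous_average_ball u G.ε))

theorem bddAbove_image (u : EuclideanSpace ℝ (Fin n) →ᵇ ℝ) (s : Set (EuclideanSpace ℝ (Fin n))) :
    BddAbove (u '' s) :=
  ⟨‖u‖, by rintro _ ⟨y, -, rfl⟩; exact u.apply_le_norm y⟩

theorem bddBelow_image (u : EuclideanSpace ℝ (Fin n) →ᵇ ℝ) (s : Set (EuclideanSpace ℝ (Fin n))) :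
    BddBelow (u '' s) :=
  ⟨-‖u‖, by rintro _ ⟨y, -, rfl⟩; exact u.neg_norm_le_apply y⟩

theorem integrable_uniform (u : EuclideanSpace ℝ (Fin n) →ᵇ ℝ) (x : EuclideanSpace ℝ (Fin n)) :
    Integrable u (G.uniform x) := u.integrable _

/-- The supremum and infimum see the perturbation only through its bound `D * A`, while the average
sees `V` itself. The resulting term is exactly the left side of the Lyapunov inequality. -/
theorem mean_le_mean_add {u v V : EuclideanSpace ℝ (Fin n) →ᵇ ℝ} {A D : ℝ} (hD : 0 ≤ D)
    (hV : ∀ x, V x ≤ A) (huv : ∀ x, u x ≤ v x + D * V x) (x : EuclideanSpace ℝ (Fin n)) :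
    G.mean u x ≤ G.mean v x + D * (G.α * A + G.β * ∫ y, V y ∂(G.uniform x)) := by
  have hne : (Metric.ball x G.ε).Nonempty := Metric.nonempty_ball.2 G.ε_pos
  have huA : ∀ y, u y ≤ v y + D * A := fun y =>
    (huv y).trans (by have := mul_le_mul_of_nonneg_left (hV y) hD; linarith)
  have h1 : sSup (u '' Metric.ball x G.ε) ≤ sSup (v '' Metric.ball x G.ε) + D * A := by
    refine csSup_le (hne.image _) ?_
    rintro _ ⟨y, hy, rfl⟩
    linarith [huA y, le_csSup (bddAbove_image v _) (mem_image_of_mem v hy)]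
  have h2 : sInf (u '' Metric.ball x G.ε) - D * A ≤ sInf (v '' Metric.ball x G.ε) := by
    refine le_csInf (hne.image _) ?_
    rintro _ ⟨y, hy, rfl⟩
    linarith [huA y, csInf_le (bddBelow_image u _) (mem_image_of_mem u hy)]
  have h3 : ∫ y, u y ∂(G.uniform x) ≤
      ∫ y, v y ∂(G.uniform x) + D * ∫ y, V y ∂(G.uniform x) := by
    rw [← integral_const_mul, ← integral_add (G.integrable_uniform v x)
      ((G.integrable_uniform V x).const_mul D)]
    exact integral_mono (G.integrable_uniform u x)
      ((G.integrable_uniform v x).add ((G.integrable_uniform V x).const_mul D)) huv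
  unfold mean
  rw [← G.integral_uniform, ← G.integral_uniform]
  have hα := G.α_pos
  have h1' := mul_le_mul_of_nonneg_left h1 (half_pos hα).le
  have h2' := mul_le_mul_of_nonneg_left h2 (half_pos hα).le
  have h3' := mul_le_mul_of_nonneg_left h3 G.β_pos.le
  nlinarith

theorem abs_mean_le (u : EuclideanSpace ℝ (Fin n) →ᵇ ℝ) (x : EuclideanSpace ℝ (Fin n)) :
    |G.mean u x| ≤ ‖u‖ := by
  have hne : (Metric.ball x G.ε).Nonempty := Metric.nonempty_ball.2 G.ε_pos
  obtain ⟨y, hy⟩ := hne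
  have h1 : sSup (u '' Metric.ball x G.ε) ≤ ‖u‖ := csSup_le (Set.Nonempty.image _ ⟨y, hy⟩) (by
    rintro _ ⟨z, -, rfl⟩; exact u.apply_le_norm z)
  have h2 : -‖u‖ ≤ sInf (u '' Metric.ball x G.ε) := le_csInf (Set.Nonempty.image _ ⟨y, hy⟩) (by
    rintro _ ⟨z, -, rfl⟩; exact u.neg_norm_le_apply z)
  have h3 : -‖u‖ ≤ sSup (u '' Metric.ball x G.ε) :=
    (u.neg_norm_le_apply y).trans (le_csSup (bddAbove_image u _) (mem_image_of_mem u hy))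
  have h4 : sInf (u '' Metric.ball x G.ε) ≤ ‖u‖ :=
    (csInf_le (bddBelow_image u _) (mem_image_of_mem u hy)).trans (u.apply_le_norm y)
  have h5 : |∫ z, u z ∂(G.uniform x)| ≤ ‖u‖ := by
    have := norm_integral_le_of_norm_le_const (μ := G.uniform x)
      (ae_of_all _ fun z => u.norm_coe_le_norm z)
    simpa using this
  rw [abs_le] at h5
  unfold mean
  rw [← G.integral_uniform, abs_le]
  have hα := G.α_pos
  have hβ := G.β_pos
  have := G.α_add_β
  constructor <;> nlinarith

variable {G} in
-- At points of `Ω` the balls stay inside `Ω_ε`; at the other points `δ = 1` and the mean drops out.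
theorem SolvesDPP.congr (hn : 0 < n) {u v : EuclideanSpace ℝ (Fin n) → ℝ} (hu : G.SolvesDPP u)
    (huv : EqOn u v G.extendedDomain) : G.SolvesDPP v := by
  intro x hx
  rw [← huv hx, hu x hx]
  by_cases h : x ∈ G.Ω
  · have hb : EqOn u v (Metric.ball x G.ε) := huv.mono (G.ball_subset_extendedDomain h)
    rw [image_congr hb, setAverage_congr_fun measurableSet_ball (ae_of_all _ hb)]
  · rw [G.stopProb_eq_one hn hx h]
    simp

theorem exists_solvesDPP (hn : 0 < n) :
    ∃ u : EuclideanSpace ℝ (Fin n) →ᵇ ℝ, G.SolvesDPP u := by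
  obtain ⟨V₀, A, hVc, hV1, hVA, hV⟩ := G.exists_lyapunov hn
  obtain ⟨f, hf⟩ := G.exists_stripPayoff_eq hn
  set V : EuclideanSpace ℝ (Fin n) →ᵇ ℝ := BoundedContinuousFunction.ofNormedAddCommGroup V₀ hVc A
    (fun x => by rw [Real.norm_of_nonneg (by linarith [hV1 x])]; exact hVA x)
  have hVV : ∀ x, V x = V₀ x := fun x => rfl
  have hA : 1 ≤ A := (hV1 0).trans (hVA 0)
  -- Writing the unknown as `V * w` turns the norm weighted by `V` into the ordinary supremum norm
  -- of `w`.
  let U : (EuclideanSpace ℝ (Fin n) →ᵇ ℝ) → EuclideanSpace ℝ (Fin n) →ᵇ ℝ := fun w => V * w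
  have hUV : ∀ w x, U w x = V x * w x := fun w x => rfl
  have hT : ∀ w : EuclideanSpace ℝ (Fin n) →ᵇ ℝ, ∃ w' : EuclideanSpace ℝ (Fin n) →ᵇ ℝ,
      ∀ x, w' x = ((1 - G.extendedStopProb x) * G.mean (U w) x
        + G.extendedStopProb x * f x) / V x := by
    intro w
    refine ⟨BoundedContinuousFunction.ofNormedAddCommGroup (fun x =>
      ((1 - G.extendedStopProb x) * G.mean (U w) x + G.extendedStopProb x * f x) / V x) ?_
        (‖U w‖ + ‖f‖) fun x => ?_, fun x => rfl⟩
    · refine Continuous.div ?_ V.continuous fun x => ?_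
      · exact ((continuous_const.sub G.continuous_extendedStopProb).mul
          (G.continuous_mean (U w))).add (G.continuous_extendedStopProb.mul f.continuous)
      · rw [hVV]
        linarith [hV1 x]
    · have h0 := G.extendedStopProb_nonneg x
      have h1 := G.extendedStopProb_le_one x
      have h2 := G.abs_mean_le (U w) x
      have h3 := f.norm_coe_le_norm x
      rw [norm_div, hVV, Real.norm_of_nonneg (by linarith [hV1 x] : 0 ≤ V₀ x)]
      refine (div_le_self (norm_nonneg _) (hV1 x)).trans ((norm_add_le _ _).trans ?_)
      rw [norm_mul, norm_mul, Real.norm_of_nonneg h0, Real.norm_of_nonneg (sub_nonneg.2 h1),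
        Real.norm_eq_abs]
      refine add_le_add ?_ ?_
      · nlinarith [abs_nonneg (G.mean (U w) x)]
      · nlinarith [norm_nonneg (f x)]
  choose T hT using hT
  have hq0 : (0 : ℝ) ≤ 1 - A⁻¹ := sub_nonneg.2 (inv_le_one_of_one_le₀ hA)
  -- With `D = dist w w'`, the means differ by at most `D (V x - 1)`, and `V x - 1 ≤ (1 - A⁻¹) V x`
  -- because `V ≤ A`. Outside `Ω` the means have weight zero.
  have key : ∀ w w' x, T w x ≤ T w' x + (1 - A⁻¹) * dist w w' := by
    intro w w' x
    have hVx : 0 < V x := by rw [hVV]; linarith [hV1 x]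
    rw [hT, hT, div_add' _ _ _ hVx.ne']
    refine div_le_div_of_nonneg_right ?_ hVx.le
    by_cases hx : x ∈ G.Ω
    · have hD : (0 : ℝ) ≤ dist w w' := dist_nonneg
      have h1 := G.mean_le_mean_add (u := U w) (v := U w') (V := V) hD hVA (fun y => by
        have h2 := (abs_le.1 (Real.dist_eq (w y) (w' y) ▸ w.dist_coe_le_dist y)).2
        have h3 := mul_le_mul_of_nonneg_left h2 (show 0 ≤ V y by rw [hVV]; linarith [hV1 y])
        rw [hUV, hUV]
        linarith) x
      have h2 := mul_le_mul_of_nonneg_left (hV x hx) hD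
      have h3 : V x - 1 ≤ (1 - A⁻¹) * V x := by
        have h4 : A⁻¹ * V x ≤ 1 := by
          have := mul_le_mul_of_nonneg_left (hVA x) (inv_nonneg.2 (by linarith : 0 ≤ A))
          rwa [inv_mul_cancel₀ (by linarith)] at this
        linarith
      have h4 := mul_le_mul_of_nonneg_left h3 hD
      have h5 : G.mean (U w) x ≤ G.mean (U w') x + dist w w' * ((1 - A⁻¹) * V x) :=
        h1.trans (add_le_add le_rfl (h2.trans h4))
      have h6 := mul_le_mul_of_nonneg_left h5 (sub_nonneg.2 (G.extendedStopProb_le_one x))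
      have h7 : 0 ≤ dist w w' * ((1 - A⁻¹) * V x) := by positivity
      nlinarith [mul_nonneg (G.extendedStopProb_nonneg x) h7]
    · rw [G.extendedStopProb_of_notMem hx]
      have : 0 ≤ (1 - A⁻¹) * dist w w' * V x := by positivity
      linarith
  have hcontr : ContractingWith ⟨1 - A⁻¹, hq0⟩ T := by
    refine ⟨?_, LipschitzWith.of_dist_le_mul fun w w' => ?_⟩
    · change (1 - A⁻¹ : ℝ) < 1
      have : 0 < A⁻¹ := inv_pos.2 (by linarith)
      linarith
    · change dist (T w) (T w') ≤ (1 - A⁻¹) * dist w w'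
      refine (BoundedContinuousFunction.dist_le (by positivity)).2 fun x => ?_
      rw [Real.dist_eq, abs_le]
      have h1 := key w w' x
      have h2 := key w' w x
      rw [dist_comm w' w] at h2
      constructor <;> linarith
  set w := hcontr.fixedPoint T
  have hw : T w = w := hcontr.fixedPoint_isFixedPt
  refine ⟨U w, fun x hx => ?_⟩
  have hVx : 0 < V x := by rw [hVV]; linarith [hV1 x]
  have h1 : (U w) x = (1 - G.extendedStopProb x) * G.mean (U w) x
      + G.extendedStopProb x * f x := by
    rw [hUV, ← hw, hT, hw]
    field_simp
  rw [h1, G.stopProb_eq_extendedStopProb hn hx]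
  congr 1
  rw [← G.stopProb_eq_extendedStopProb hn hx, hf]
  -- The continuous extension `f` may differ from the payoff only off the strip, where `δ = 0`.
  by_cases hs : x ∈ G.strip
  · rw [indicator_of_mem hs]
  · rw [G.stopProb_of_notMem_strip hs, zero_mul, zero_mul]

end DynamicProgramming

/-! ### One-step laws and the law of the game -/

section GameLaw

theorem integral_roundLaw {φ : Round n → ℝ} (hφ : Measurable φ) {C : ℝ} (hC : ∀ s, |φ s| ≤ C)
    (x y z : EuclideanSpace ℝ (Fin n)) :
    ∫ s, φ s ∂(G.roundLaw x y z) = G.stopProb x * φ (Outcome.stopped, x)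
      + (1 - G.stopProb x) * (G.α / 2 * φ (Outcome.playerI, y) + G.α / 2 * φ (Outcome.playerII, z)
        + G.β * ∫ w, φ (Outcome.noise, w) ∂(G.uniform x)) := by
  have hu : IsProbabilityMeasure ((G.uniform x).map (Prod.mk Outcome.noise)) :=
    Measure.isProbabilityMeasure_map measurable_prodMk_left.aemeasurable
  have hi : ∀ (μ : Measure (Round n)) [IsFiniteMeasure μ] (c : ℝ),
      Integrable φ (ENNReal.ofReal c • μ) := fun μ _ c =>
    (Integrable.of_bound hφ.aestronglyMeasurable C (ae_of_all _ hC)).smul_measure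
      ENNReal.ofReal_ne_top
  have hI : Integrable φ (ENNReal.ofReal (G.α / 2) • Measure.dirac (Outcome.playerI, y)
        + ENNReal.ofReal (G.α / 2) • Measure.dirac (Outcome.playerII, z)) :=
    (hi _ _).add_measure (hi _ _)
  have hα := G.α_pos
  have hβ := G.β_pos
  rw [roundLaw, integral_add_measure (hi _ _)
      ((hI.add_measure (hi _ _)).smul_measure ENNReal.ofReal_ne_top), integral_smul_measure,
    integral_smul_measure, integral_add_measure hI (hi _ _),
    integral_add_measure (hi _ _) (hi _ _), integral_smul_measure, integral_smul_measure,
    integral_smul_measure, integral_dirac' _ _ hφ.stronglyMeasurable,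
    integral_dirac' _ _ hφ.stronglyMeasurable, integral_dirac' _ _ hφ.stronglyMeasurable,
    integral_map measurable_prodMk_left.aemeasurable hφ.aestronglyMeasurable,
    ENNReal.toReal_ofReal (G.stopProb_nonneg x),
    ENNReal.toReal_ofReal (sub_nonneg.2 (G.stopProb_le_one x)), ENNReal.toReal_ofReal (by linarith),
    ENNReal.toReal_ofReal hβ.le]
  rfl

theorem ae_roundLaw {p : Round n → Prop} (hp : MeasurableSet {s | p s})
    {x y z : EuclideanSpace ℝ (Fin n)}
    (hδf : G.stopProb x ≠ 0 → p (Outcome.stopped, x))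
    (hmove : G.stopProb x ≠ 1 → p (Outcome.playerI, y) ∧ p (Outcome.playerII, z) ∧
      ∀ w ∈ Metric.ball x G.ε, p (Outcome.noise, w)) :
    ∀ᵐ s ∂(G.roundLaw x y z), p s := by
  rw [roundLaw, ae_add_measure_iff]
  constructor
  · by_cases h : G.stopProb x = 0
    · simp [h]
    · exact Measure.ae_smul_measure ((ae_dirac_iff hp).2 (hδf h)) _
  · by_cases h : G.stopProb x = 1
    · simp [h]
    · obtain ⟨h1, h2, h3⟩ := hmove h
      refine Measure.ae_smul_measure ?_ _
      rw [ae_add_measure_iff, ae_add_measure_iff]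
      refine ⟨⟨Measure.ae_smul_measure ((ae_dirac_iff hp).2 h1) _,
        Measure.ae_smul_measure ((ae_dirac_iff hp).2 h2) _⟩, Measure.ae_smul_measure ?_ _⟩
      rw [ae_map_iff measurable_prodMk_left.aemeasurable hp]
      exact (G.ae_mem_ball_uniform x).mono h3

variable (S T : Strategy n G.ε) (x₀ : EuclideanSpace ℝ (Fin n))

theorem nextLaw_of_stopped {k : ℕ} {h : History n k} (hh : h.last.1 = Outcome.stopped) :
    G.nextLaw S T k h = Measure.dirac h.last := if_pos hh

theorem nextLaw_of_not_stopped {k : ℕ} {h : History n k} (hh : h.last.1 ≠ Outcome.stopped) :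
    G.nextLaw S T k h = G.roundLaw h.position (S.move k h) (T.move k h) := if_neg hh

instance isProbabilityMeasure_gameLaw : IsProbabilityMeasure (G.gameLaw S T x₀) := by
  unfold gameLaw
  infer_instance

/-- The one-step description of the game: given the history, the next state has law `step`. Both the
almost sure and the expectation statements about a round are derived from it. -/
theorem map_gameLaw_eq_compProd (k : ℕ) :
    (G.gameLaw S T x₀).map (fun ω => (Preorder.frestrictLe k ω, ω (k + 1))) =
      ((G.gameLaw S T x₀).map (Preorder.frestrictLe k)) ⊗ₘ G.step S T k := by
  unfold gameLaw
  rw [Kernel.traj_map_frestrictLe_apply]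
  exact (Kernel.partialTraj_compProd_eq_map_traj (X := fun _ => Round n) (κ := G.step S T)
    (Nat.zero_le k)).symm

theorem ae_gameLaw_zero : ∀ᵐ ω ∂(G.gameLaw S T x₀), ω 0 = (Outcome.start, x₀) := by
  have h := Kernel.traj_map_frestrictLe_apply (X := fun _ => Round n) (κ := G.step S T) 0 0
    (fun _ => (Outcome.start, x₀))
  rw [Kernel.partialTraj_self, Kernel.id_apply] at h
  have hm : MeasurableSet {h : History n 0 | h.position = x₀ ∧ h.last.1 = Outcome.start} :=
    (History.measurable_position (measurableSet_singleton x₀)).inter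
      ((measurable_fst.comp History.measurable_last) (show MeasurableSet {Outcome.start} from trivial))
  have h2 : ∀ᵐ h ∂((G.gameLaw S T x₀).map (Preorder.frestrictLe 0)),
      h ∈ {h : History n 0 | h.position = x₀ ∧ h.last.1 = Outcome.start} := by
    unfold gameLaw
    rw [h]
    exact (ae_dirac_iff hm).2 ⟨rfl, rfl⟩
  filter_upwards [ae_of_ae_map (Preorder.measurable_frestrictLe 0).aemeasurable h2] with ω hω
  exact Prod.ext hω.2 hω.1

variable {S T x₀}

theorem ae_gameLaw_step {k : ℕ} {p : History n k → Round n → Prop}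
    (hp : MeasurableSet {q : History n k × Round n | p q.1 q.2})
    (h : ∀ h, ∀ᵐ s ∂(G.nextLaw S T k h), p h s) :
    ∀ᵐ ω ∂(G.gameLaw S T x₀), p (Preorder.frestrictLe k ω) (ω (k + 1)) := by
  have h1 : ∀ᵐ q ∂(((G.gameLaw S T x₀).map (Preorder.frestrictLe k)) ⊗ₘ G.step S T k),
      p q.1 q.2 := Measure.ae_compProd_of_ae_ae hp (ae_of_all _ h)
  rw [← map_gameLaw_eq_compProd] at h1
  exact ae_of_ae_map (by fun_prop) h1

theorem integral_gameLaw_succ {φ : Round n → ℝ} (hφ : Measurable φ) {C : ℝ}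
    (hC : ∀ s, |φ s| ≤ C) (k : ℕ) :
    ∫ ω, φ (ω (k + 1)) ∂(G.gameLaw S T x₀) =
      ∫ ω, ∫ s, φ s ∂(G.nextLaw S T k (Preorder.frestrictLe k ω)) ∂(G.gameLaw S T x₀) := by
  have hP : IsProbabilityMeasure ((G.gameLaw S T x₀).map
      (Preorder.frestrictLe (π := fun _ => Round n) k)) :=
    Measure.isProbabilityMeasure_map (Preorder.measurable_frestrictLe k).aemeasurable
  have h1 : ∫ ω, φ (ω (k + 1)) ∂(G.gameLaw S T x₀) =
      ∫ q, φ q.2 ∂((G.gameLaw S T x₀).map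
        (fun ω => (Preorder.frestrictLe (π := fun _ => Round n) k ω, ω (k + 1)))) := by
    have hm : AEStronglyMeasurable (fun q : History n k × Round n => φ q.2)
        ((G.gameLaw S T x₀).map
          (fun ω => (Preorder.frestrictLe (π := fun _ => Round n) k ω, ω (k + 1)))) :=
      (hφ.comp measurable_snd).aestronglyMeasurable
    rw [integral_map (by fun_prop) hm]
  rw [h1, map_gameLaw_eq_compProd, Measure.integral_compProd, integral_map (by fun_prop)]
  · rfl
  · exact (hφ.comp measurable_snd).stronglyMeasurable.integral_kernel_prod_right'
      (κ := G.step S T k) |>.aestronglyMeasurable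
  · exact Integrable.of_bound (hφ.comp measurable_snd).aestronglyMeasurable C
      (ae_of_all _ fun q => hC _)

/-- The states which can occur in the game: positions in `Ω_ε`, stopped only in the strip. -/
def admissible : Set (Round n) :=
  {s | s.2 ∈ G.extendedDomain ∧ (s.1 = Outcome.stopped → s.2 ∈ G.strip)}

theorem measurableSet_admissible : MeasurableSet G.admissible := by
  have h1 : MeasurableSet {s : Round n | s.1 = Outcome.stopped} :=
    measurable_fst (show MeasurableSet {Outcome.stopped} from trivial)
  exact (measurable_snd G.isClosed_extendedDomain.measurableSet).inter
    (h1.imp (measurable_snd G.isClosed_strip.measurableSet))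

theorem ae_nextLaw_admissible (hn : 0 < n) {k : ℕ} {h : History n k}
    (hh : h.last ∈ G.admissible) : ∀ᵐ s ∂(G.nextLaw S T k h), s ∈ G.admissible := by
  by_cases hs : h.last.1 = Outcome.stopped
  · rw [G.nextLaw_of_stopped S T hs]
    exact (ae_dirac_iff G.measurableSet_admissible).2 hh
  · rw [G.nextLaw_of_not_stopped S T hs]
    refine G.ae_roundLaw G.measurableSet_admissible (fun hδ => ⟨hh.1, fun _ => ?_⟩) fun hδ => ?_
    · by_contra hx
      exact hδ (G.stopProb_of_notMem_strip hx)
    · have hx : h.position ∈ G.Ω := by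
        by_contra hx
        exact hδ (G.stopProb_eq_one hn hh.1 hx)
      have hb := G.ball_subset_extendedDomain hx
      exact ⟨⟨hb (S.move_mem k h), fun h => nomatch h⟩, ⟨hb (T.move_mem k h), fun h => nomatch h⟩,
        fun w hw => ⟨hb hw, fun h => nomatch h⟩⟩

theorem ae_admissible (hn : 0 < n) (hx₀ : x₀ ∈ G.extendedDomain) :
    ∀ᵐ ω ∂(G.gameLaw S T x₀), ∀ k, ω k ∈ G.admissible := by
  have hstep : ∀ᵐ ω ∂(G.gameLaw S T x₀), ∀ k, ω k ∈ G.admissible → ω (k + 1) ∈ G.admissible := by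
    refine ae_all_iff.2 fun k => ?_
    refine G.ae_gameLaw_step (p := fun h s => h.last ∈ G.admissible → s ∈ G.admissible) ?_ ?_
    · exact ((History.measurable_last.comp measurable_fst) G.measurableSet_admissible).imp
        (measurable_snd G.measurableSet_admissible)
    · intro h
      by_cases hh : h.last ∈ G.admissible
      · exact (G.ae_nextLaw_admissible hn hh).mono fun s hs _ => hs
      · exact ae_of_all _ fun s hs => absurd hs hh
  filter_upwards [hstep, G.ae_gameLaw_zero S T x₀] with ω hω h0 k
  induction k with
  | zero =>
    rw [h0]
    exact ⟨hx₀, fun h => nomatch h⟩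
  | succ k ih => exact hω k ih

theorem ae_stays_stopped : ∀ᵐ ω ∂(G.gameLaw S T x₀),
    ∀ k, (ω k).1 = Outcome.stopped → ω (k + 1) = ω k := by
  refine ae_all_iff.2 fun k => ?_
  have hm : ∀ h : History n k, MeasurableSet {s : Round n | s = h.last} := fun h => by
    have : {s : Round n | s = h.last} = {h.last.1} ×ˢ {h.last.2} := by
      ext s
      simp [Prod.ext_iff]
    rw [this]
    exact MeasurableSet.prod trivial (measurableSet_singleton _)
  refine G.ae_gameLaw_step (p := fun h s => h.last.1 = Outcome.stopped → s = h.last) ?_ ?_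
  · have : {q : History n k × Round n | q.1.last.1 = Outcome.stopped → q.2 = q.1.last} =
        {q | q.1.last.1 = Outcome.stopped → q.2.1 = Outcome.stopped ∧ q.2.2 = q.1.last.2} := by
      ext q
      simp only [mem_ofPred_eq, Prod.ext_iff]
      constructor
      · exact fun h hq => ⟨(h hq).1.trans hq, (h hq).2⟩
      · exact fun h hq => ⟨(h hq).1.trans hq.symm, (h hq).2⟩
    rw [this]
    have hs : MeasurableSet {Outcome.stopped} := trivial
    refine MeasurableSet.imp
      ((measurable_fst.comp (History.measurable_last.comp measurable_fst)) hs)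
      (((measurable_fst.comp measurable_snd) hs).inter (measurableSet_eq_fun
        (measurable_snd.comp measurable_snd)
        (measurable_snd.comp (History.measurable_last.comp measurable_fst))))
  · intro h
    by_cases hh : h.last.1 = Outcome.stopped
    · rw [G.nextLaw_of_stopped S T hh]
      exact (ae_dirac_iff ((MeasurableSet.const _).imp (hm h))).2 fun _ => rfl
    · exact ae_of_all _ fun s hs => absurd hs hh

theorem integrable_gameLaw {φ : Round n → ℝ} (hφ : Measurable φ) {C : ℝ}
    (hC : ∀ s, |φ s| ≤ C) (k : ℕ) : Integrable (fun ω => φ (ω k)) (G.gameLaw S T x₀) :=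
  Integrable.of_bound (hφ.comp (measurable_pi_apply k)).aestronglyMeasurable C
    (ae_of_all _ fun _ => hC _)

/-- If the expectation of `φ` decreases at least by the factor `q` in each round, then it decays
at least geometrically along the game. -/
theorem integral_gameLaw_le (hn : 0 < n) (hx₀ : x₀ ∈ G.extendedDomain) {φ : Round n → ℝ}
    (hφ : Measurable φ) {C : ℝ} (hC : ∀ s, |φ s| ≤ C) {q : ℝ} (hq : 0 ≤ q)
    (h : ∀ k (h : History n k), h.last ∈ G.admissible →
      ∫ s, φ s ∂(G.nextLaw S T k h) ≤ q * φ h.last) (k : ℕ) :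
    ∫ ω, φ (ω k) ∂(G.gameLaw S T x₀) ≤ q ^ k * φ (Outcome.start, x₀) := by
  induction k with
  | zero =>
    refine le_of_eq ?_
    rw [integral_congr_ae (g := fun _ => φ (Outcome.start, x₀)), integral_const, probReal_univ]
    · simp
    · filter_upwards [G.ae_gameLaw_zero S T x₀] with ω hω
      rw [hω]
  | succ k ih =>
    have hle : ∫ ω, φ (ω (k + 1)) ∂(G.gameLaw S T x₀) ≤
        ∫ ω, q * φ (ω k) ∂(G.gameLaw S T x₀) := by
      -- Conditioning on the history reduces the claim to the one-step hypothesis, which is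
      -- available because states are almost surely admissible.
      rw [G.integral_gameLaw_succ hφ hC]
      refine integral_mono_ae ?_ ((G.integrable_gameLaw hφ hC k).const_mul q) ?_
      · refine Integrable.of_bound (C := C) ?_ (ae_of_all _ fun ω => ?_)
        · exact ((hφ.stronglyMeasurable.integral_kernel (κ := G.step S T k)).measurable.comp
            (Preorder.measurable_frestrictLe k)).aestronglyMeasurable
        · have : IsProbabilityMeasure (G.nextLaw S T k (Preorder.frestrictLe k ω)) :=
            (G.isMarkovKernel_step S T k).isProbabilityMeasure _
          have := norm_integral_le_of_norm_le_const
            (μ := G.nextLaw S T k (Preorder.frestrictLe k ω)) (f := φ) (ae_of_all _ hC)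
          simpa using this
      · filter_upwards [G.ae_admissible (S := S) (T := T) hn hx₀] with ω hω
        exact h k _ (hω k)
    rw [integral_const_mul] at hle
    refine hle.trans ((mul_le_mul_of_nonneg_left ih hq).trans_eq ?_)
    ring

end GameLaw

/-! ### Termination, near-optimal strategies and the value -/

section Value

open Classical in
/-- The reward `f` at the current position if the game has been stopped, and the value `w` of the
current position otherwise. -/
def stateValue (f w : EuclideanSpace ℝ (Fin n) → ℝ) (s : Round n) : ℝ :=
  if s.1 = Outcome.stopped then f s.2 else w s.2

theorem stateValue_stopped (f w : EuclideanSpace ℝ (Fin n) → ℝ) {s : Round n}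
    (hs : s.1 = Outcome.stopped) : stateValue f w s = f s.2 := if_pos hs

theorem stateValue_not_stopped (f w : EuclideanSpace ℝ (Fin n) → ℝ) {s : Round n}
    (hs : s.1 ≠ Outcome.stopped) : stateValue f w s = w s.2 := if_neg hs

theorem measurable_stateValue {f w : EuclideanSpace ℝ (Fin n) → ℝ} (hf : Measurable f)
    (hw : Measurable w) : Measurable (stateValue f w) :=
  Measurable.ite (measurable_fst (show MeasurableSet {Outcome.stopped} from trivial))
    (hf.comp measurable_snd) (hw.comp measurable_snd)

theorem abs_stateValue_le {f w : EuclideanSpace ℝ (Fin n) → ℝ} {C D : ℝ} (hf : ∀ x, |f x| ≤ C)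
    (hw : ∀ x, |w x| ≤ D) (s : Round n) : |stateValue f w s| ≤ max C D := by
  unfold stateValue
  split_ifs
  · exact (hf _).trans (le_max_left _ _)
  · exact (hw _).trans (le_max_right _ _)

/-- The step at which the game is stopped. -/
def stopTime (ω : ℕ → Round n) : ℕ := sInf {k | (ω k).1 = Outcome.stopped}

variable {S T : Strategy n G.ε} {x₀ : EuclideanSpace ℝ (Fin n)}

/-- If `w` decreases in expectation in each round, up to the factor `q`, then so does the
state value. -/
theorem integral_nextLaw_stateValue_le {f w : EuclideanSpace ℝ (Fin n) → ℝ} (hf : Measurable f)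
    (hw : Measurable w) {C D : ℝ} (hC : ∀ x, |f x| ≤ C) (hD : ∀ x, |w x| ≤ D) {q : ℝ}
    (hδf : ∀ x, f x ≤ q * f x) {k : ℕ} {h : History n k}
    (hstep : G.stopProb h.position * f h.position + (1 - G.stopProb h.position) *
      (G.α / 2 * w (S.move k h) + G.α / 2 * w (T.move k h)
        + G.β * ∫ y, w y ∂(G.uniform h.position)) ≤ q * w h.position) :
    ∫ s, stateValue f w s ∂(G.nextLaw S T k h) ≤ q * stateValue f w h.last := by
  have hm := measurable_stateValue hf hw
  by_cases hs : h.last.1 = Outcome.stopped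
  · rw [G.nextLaw_of_stopped S T hs, integral_dirac' _ _ hm.stronglyMeasurable,
      stateValue_stopped f w hs]
    exact hδf _
  · rw [G.nextLaw_of_not_stopped S T hs, G.integral_roundLaw hm (abs_stateValue_le hC hD),
      stateValue_not_stopped f w hs, stateValue_stopped f w rfl,
      stateValue_not_stopped (s := (Outcome.playerI, _)) f w (fun h => nomatch h),
      stateValue_not_stopped (s := (Outcome.playerII, _)) f w (fun h => nomatch h)]
    have hnoise : ∀ y, stateValue f w (Outcome.noise, y) = w y := fun y =>
      stateValue_not_stopped f w (fun h => nomatch h)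
    simp_rw [hnoise]
    exact hstep

theorem ae_exists_stopped (hn : 0 < n) (hx₀ : x₀ ∈ G.extendedDomain) :
    ∀ᵐ ω ∂(G.gameLaw S T x₀), ∃ k, (ω k).1 = Outcome.stopped := by
  obtain ⟨V, A, hVc, hV1, hVA, hV⟩ := G.exists_lyapunov hn
  have hA : 1 ≤ A := (hV1 0).trans (hVA 0)
  have hq : 0 ≤ 1 - A⁻¹ := sub_nonneg.2 (inv_le_one_of_one_le₀ hA)
  have hf0 : Measurable (fun _ : EuclideanSpace ℝ (Fin n) => (0 : ℝ)) := measurable_const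
  have hVabs : ∀ x, |V x| ≤ A := fun x => by
    rw [abs_of_nonneg (by linarith [hV1 x])]
    exact hVA x
  have hbd := abs_stateValue_le (f := fun _ : EuclideanSpace ℝ (Fin n) => (0 : ℝ)) (C := 0)
    (by simp) hVabs
  -- State value with reward `0` after stopping and `V` before: its expectation shrinks by the
  -- factor `1 - A⁻¹` per round.
  have hdecay := G.integral_gameLaw_le (S := S) (T := T) hn hx₀
    (measurable_stateValue hf0 hVc.measurable) hbd hq fun k h hh => by
      refine G.integral_nextLaw_stateValue_le hf0 hVc.measurable (C := 0) (by simp) hVabs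
        (by simp) ?_
      have hqV : 0 ≤ (1 - A⁻¹) * V h.position := mul_nonneg hq (by linarith [hV1 h.position])
      by_cases hx : h.position ∈ G.Ω
      · have h1 : A⁻¹ * V h.position ≤ 1 := by
          have := mul_le_mul_of_nonneg_left (hVA h.position) (inv_nonneg.2 (by linarith : 0 ≤ A))
          rwa [inv_mul_cancel₀ (by linarith)] at this
        have hα := (half_pos G.α_pos).le
        have h2 := mul_le_mul_of_nonneg_left (hVA (S.move k h)) hα
        have h3 := mul_le_mul_of_nonneg_left (hVA (T.move k h)) hα
        have h4 := hV _ hx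
        have h5 : G.α / 2 * V (S.move k h) + G.α / 2 * V (T.move k h)
            + G.β * ∫ y, V y ∂(G.uniform h.position) ≤ (1 - A⁻¹) * V h.position := by linarith
        have h6 := mul_le_mul_of_nonneg_left h5 (sub_nonneg.2 (G.stopProb_le_one h.position))
        have h7 := mul_nonneg (G.stopProb_nonneg h.position) hqV
        linarith
      · rw [G.stopProb_eq_one (x := h.position) hn hh.1 hx]
        linarith
  set N : Set (ℕ → Round n) := {ω | ∀ k, (ω k).1 ≠ Outcome.stopped} with hN
  have hNm : MeasurableSet N := by
    rw [hN, ofPred_forall]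
    exact MeasurableSet.iInter fun k => (measurable_fst.comp (measurable_pi_apply k))
      (show MeasurableSet {o | o ≠ Outcome.stopped} from trivial)
  -- On the event `N` of never stopping, the state value is `V ≥ 1` at every step, so its
  -- expectation dominates the probability of `N`.
  have hle : ∀ k, (G.gameLaw S T x₀).real N ≤ (1 - A⁻¹) ^ k * V x₀ := by
    intro k
    have hk := hdecay k
    rw [stateValue_not_stopped (s := (Outcome.start, x₀)) _ _ (fun h => nomatch h)] at hk
    refine le_trans ?_ hk
    rw [← mul_one ((G.gameLaw S T x₀).real N), ← smul_eq_mul, ← integral_indicator_const _ hNm]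
    refine integral_mono ((integrable_const _).indicator hNm)
      (G.integrable_gameLaw (measurable_stateValue hf0 hVc.measurable) hbd k) fun ω => ?_
    by_cases hω : ω ∈ N
    · rw [indicator_of_mem hω]
      simpa only [stateValue_not_stopped _ _ (hω k)] using hV1 _
    · rw [indicator_of_notMem hω]
      dsimp only [stateValue]
      split_ifs
      · exact le_rfl
      · linarith [hV1 (ω k).2]
  have hlim : Tendsto (fun k : ℕ => (1 - A⁻¹) ^ k * V x₀) atTop (𝓝 0) := by
    have h1 : 0 < A⁻¹ := inv_pos.2 (by linarith)
    simpa using (tendsto_pow_atTop_nhds_zero_of_lt_one hq (by linarith)).mul_const (V x₀)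
  have h0 : (G.gameLaw S T x₀).real N = 0 :=
    le_antisymm (ge_of_tendsto' hlim hle) measureReal_nonneg
  rw [measureReal_eq_zero_iff] at h0
  filter_upwards [measure_eq_zero_iff_ae_notMem.1 h0] with ω hω
  simpa [hN] using hω

theorem ae_eventually_eq_stopTime (hn : 0 < n) (hx₀ : x₀ ∈ G.extendedDomain) :
    ∀ᵐ ω ∂(G.gameLaw S T x₀), (ω (stopTime ω)).1 = Outcome.stopped ∧
      ∀ᶠ k in atTop, ω k = ω (stopTime ω) := by
  filter_upwards [G.ae_exists_stopped hn hx₀, G.ae_stays_stopped] with ω hω hstay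
  have hτ : (ω (stopTime ω)).1 = Outcome.stopped := Nat.sInf_mem hω
  refine ⟨hτ, eventually_atTop.2 ⟨stopTime ω, fun k hk => ?_⟩⟩
  induction k, hk using Nat.le_induction with
  | base => rfl
  | succ k _ ih => exact (hstay k (ih ▸ hτ)).trans ih

theorem ae_tendsto_stateValue (hn : 0 < n) (hx₀ : x₀ ∈ G.extendedDomain)
    (f w : EuclideanSpace ℝ (Fin n) → ℝ) :
    ∀ᵐ ω ∂(G.gameLaw S T x₀), Tendsto (fun k => stateValue f w (ω k)) atTop
      (𝓝 (f (ω (stopTime ω)).2)) := by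
  filter_upwards [G.ae_eventually_eq_stopTime hn hx₀] with ω hω
  refine tendsto_const_nhds.congr' (hω.2.mono fun k hk => ?_)
  beta_reduce
  rw [hk, stateValue_stopped f w hω.1]

/-- Measurability comes from writing the reward as an almost sure limit of functions of `ω k`, which
avoids any discussion of the stopping time. -/
theorem integrable_stopped (hn : 0 < n) (hx₀ : x₀ ∈ G.extendedDomain)
    {f : EuclideanSpace ℝ (Fin n) → ℝ} (hf : Measurable f) {C : ℝ} (hC : ∀ x, |f x| ≤ C) :
    Integrable (fun ω => f (ω (stopTime ω)).2) (G.gameLaw S T x₀) := by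
  refine Integrable.of_bound (C := C) ?_ (ae_of_all _ fun ω => hC _)
  exact (aemeasurable_of_tendsto_metrizable_ae atTop
    (fun k => ((measurable_stateValue hf hf).comp (measurable_pi_apply k)).aemeasurable)
    (G.ae_tendsto_stateValue hn hx₀ f f)).aestronglyMeasurable

/-- A function which decreases in expectation in each round bounds the expected reward. -/
theorem integral_stopped_le (hn : 0 < n) (hx₀ : x₀ ∈ G.extendedDomain)
    {f w : EuclideanSpace ℝ (Fin n) → ℝ} (hf : Measurable f)
    (hw : Measurable w) {C D : ℝ} (hC : ∀ x, |f x| ≤ C) (hD : ∀ x, |w x| ≤ D)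
    (hstep : ∀ k (h : History n k), h.position ∈ G.extendedDomain →
      G.stopProb h.position * f h.position + (1 - G.stopProb h.position) *
        (G.α / 2 * w (S.move k h) + G.α / 2 * w (T.move k h)
          + G.β * ∫ y, w y ∂(G.uniform h.position)) ≤ w h.position) :
    ∫ ω, f (ω (stopTime ω)).2 ∂(G.gameLaw S T x₀) ≤ w x₀ := by
  have hm := measurable_stateValue hf hw
  have hbd := abs_stateValue_le hC hD
  have hle := G.integral_gameLaw_le (S := S) (T := T) hn hx₀ hm hbd zero_le_one
    fun k h hh => G.integral_nextLaw_stateValue_le hf hw hC hD (by simp)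
      (by rw [one_mul]; exact hstep k h hh.1)
  -- The state value at step `k` has expectation at most `w x₀`, is bounded, and converges almost
  -- surely to the reward, so dominated convergence applies.
  refine le_of_tendsto' (tendsto_integral_of_dominated_convergence (fun _ => max C D)
    (fun k => (hm.comp (measurable_pi_apply k)).aestronglyMeasurable) (integrable_const _)
    (fun k => ae_of_all _ fun ω => hbd _) (G.ae_tendsto_stateValue hn hx₀ f w)) fun k => ?_
  have := hle k
  rwa [one_pow, one_mul,
    stateValue_not_stopped (s := (Outcome.start, x₀)) f w (fun h => nomatch h)] at this

/-- Borel selection of almost minimal points of `u` in the balls `B_r(x)`. -/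
theorem exists_measurable_almost_minimizer (u : EuclideanSpace ℝ (Fin n) →ᵇ ℝ) {r η : ℝ}
    (hr : 0 < r) (hη : 0 < η) : ∃ m : EuclideanSpace ℝ (Fin n) → EuclideanSpace ℝ (Fin n),
      Measurable m ∧ ∀ x, m x ∈ Metric.ball x r ∧
        u (m x) < sInf (u '' Metric.ball x r) + η := by
  classical
  set d := TopologicalSpace.denseSeq (EuclideanSpace ℝ (Fin n))
  have hex : ∀ x, ∃ i, d i ∈ Metric.ball x r ∧ u (d i) < sInf (u '' Metric.ball x r) + η := by
    intro x
    obtain ⟨_, ⟨y, hy, rfl⟩, hyu⟩ := exists_lt_of_csInf_lt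
      ((Metric.nonempty_ball.2 hr).image u) (lt_add_of_pos_right (sInf (u '' Metric.ball x r)) hη)
    have ho : IsOpen {y | y ∈ Metric.ball x r ∧ u y < sInf (u '' Metric.ball x r) + η} :=
      Metric.isOpen_ball.inter (isOpen_lt u.continuous continuous_const)
    exact (TopologicalSpace.denseRange_denseSeq _).exists_mem_open ho ⟨y, hy, hyu⟩
  -- The first suitable point of a dense sequence is selected. Each index is suitable on an open set
  -- of `x`, since the infimum over the ball is continuous in `x`.
  refine ⟨fun x => d (Nat.find (hex x)), ?_, fun x => Nat.find_spec (hex x)⟩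
  refine (measurable_from_top (f := d)).comp (measurable_find hex fun i => ?_)
  refine IsOpen.measurableSet (IsOpen.inter ?_ ?_)
  · exact isOpen_lt (continuous_const.dist continuous_id) continuous_const
  · exact isOpen_lt continuous_const
      ((continuous_sInf_image_ball u.continuous hr).add continuous_const)

/-- The strategy which applies the same rule to the current point in all rounds. -/
def _root_.Strategy.ofMap {ε : ℝ} (m : EuclideanSpace ℝ (Fin n) → EuclideanSpace ℝ (Fin n))
    (hm : Measurable m) (hmem : ∀ x, m x ∈ Metric.ball x ε) : Strategy n ε where
  move _ h := m h.position
  measurable_move _ := hm.comp History.measurable_position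
  move_mem _ _ := hmem _

theorem _root_.Information.allows_ofMap {ε : ℝ} (a : Information)
    {m : EuclideanSpace ℝ (Fin n) → EuclideanSpace ℝ (Fin n)} (hm : Measurable m)
    (hmem : ∀ x, m x ∈ Metric.ball x ε) : a.Allows (Strategy.ofMap m hm hmem) := by
  cases a with
  | currentPoint => exact fun k l h h' hh => congrArg m hh
  | currentPointAndRound => exact fun k h h' hh => congrArg m hh
  | points => exact fun k h h' hh => congrArg m (hh _)
  | pointsAndCoins => trivial

/-- The function `u + η V` decreases in expectation: in `Ω` the loss `η` of a round is compensated
by the drop of `η V`, and elsewhere the game stops at once. Keeping `f` and `M` general allows the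
use for both `u` and `-u`. -/
theorem integral_stopped_le_add (hn : 0 < n) (hx₀ : x₀ ∈ G.extendedDomain)
    {V : EuclideanSpace ℝ (Fin n) → ℝ} {A : ℝ} (hVc : Continuous V) (hV1 : ∀ x, 1 ≤ V x)
    (hVA : ∀ x, V x ≤ A)
    (hV : ∀ x ∈ G.Ω, G.α * A + G.β * ∫ y, V y ∂(G.uniform x) ≤ V x - 1)
    (u : EuclideanSpace ℝ (Fin n) →ᵇ ℝ) {f M : EuclideanSpace ℝ (Fin n) → ℝ} (hf : Measurable f)
    {C : ℝ} (hC : ∀ x, |f x| ≤ C)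
    (hu : ∀ x ∈ G.extendedDomain, u x = (1 - G.stopProb x) * M x + G.stopProb x * f x)
    {η : ℝ} (hη : 0 < η)
    (hstep : ∀ k (h : History n k), G.α / 2 * u (S.move k h) + G.α / 2 * u (T.move k h)
      + G.β * ∫ y, u y ∂(G.uniform h.position) ≤ M h.position + η) :
    ∫ ω, f (ω (stopTime ω)).2 ∂(G.gameLaw S T x₀) ≤ u x₀ + η * V x₀ := by
  have hVabs : ∀ x, |V x| ≤ A := fun x => by
    rw [abs_of_nonneg (by linarith [hV1 x])]
    exact hVA x
  refine G.integral_stopped_le hn hx₀ (w := fun x => u x + η * V x) (D := ‖u‖ + η * A) hf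
    (by fun_prop) hC (fun x => ?_) fun k h hx => ?_
  · refine (abs_add_le _ _).trans (add_le_add (u.norm_coe_le_norm x) ?_)
    rw [abs_mul, abs_of_pos hη]
    exact mul_le_mul_of_nonneg_left (hVabs x) hη.le
  · have hηV : 0 < η * V h.position := mul_pos hη (by linarith [hV1 h.position])
    rw [hu _ hx]
    by_cases hΩ : h.position ∈ G.Ω
    · have hVi : Integrable V (G.uniform h.position) :=
        Integrable.of_bound hVc.aestronglyMeasurable A (ae_of_all _ hVabs)
      rw [integral_add (G.integrable_uniform u _) (hVi.const_mul η), integral_const_mul]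
      have hα := (half_pos G.α_pos).le
      have h2 := mul_le_mul_of_nonneg_left (hVA (S.move k h)) hα
      have h3 := mul_le_mul_of_nonneg_left (hVA (T.move k h)) hα
      have h4 : η * (G.α / 2 * V (S.move k h) + G.α / 2 * V (T.move k h)
          + G.β * ∫ y, V y ∂(G.uniform h.position)) ≤ η * (V h.position - 1) :=
        mul_le_mul_of_nonneg_left (by linarith [hV _ hΩ]) hη.le
      have h5 := hstep k h
      have h6 : G.α / 2 * (u (S.move k h) + η * V (S.move k h))
          + G.α / 2 * (u (T.move k h) + η * V (T.move k h))
          + G.β * (∫ y, u y ∂(G.uniform h.position) + η * ∫ y, V y ∂(G.uniform h.position))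
          ≤ M h.position + η * V h.position := by linarith
      have h7 := mul_le_mul_of_nonneg_left h6 (sub_nonneg.2 (G.stopProb_le_one h.position))
      have h8 := mul_nonneg (G.stopProb_nonneg h.position) hηV.le
      linarith
    · rw [G.stopProb_eq_one hn hx hΩ]
      linarith

/-- Player II moves to near-minimal points of `u` with tolerance `e / V x₀`, so that the accumulated
error is `e`. Player I cannot gain more than the supremum of `u` over the ball. -/
theorem exists_strategy_le (hn : 0 < n) {u : EuclideanSpace ℝ (Fin n) →ᵇ ℝ} (hu : G.SolvesDPP u)
    (hx₀ : x₀ ∈ G.extendedDomain) {e : ℝ} (he : 0 < e) :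
    ∃ T : Strategy n G.ε, (∀ a : Information, a.Allows T) ∧
      ∀ S : Strategy n G.ε, G.expectedPayoff S T x₀ ≤ u x₀ + e := by
  obtain ⟨V, A, hVc, hV1, hVA, hV⟩ := G.exists_lyapunov hn
  obtain ⟨C, hC⟩ := G.exists_abs_stripPayoff_le hn
  have hVx : 0 < V x₀ := by linarith [hV1 x₀]
  have hη : 0 < e / V x₀ := div_pos he hVx
  obtain ⟨m, hm, hmu⟩ := exists_measurable_almost_minimizer u G.ε_pos hη
  refine ⟨Strategy.ofMap m hm fun x => (hmu x).1, fun a => a.allows_ofMap _ _, fun S => ?_⟩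
  have := G.integral_stopped_le_add (S := S) (T := Strategy.ofMap m hm fun x => (hmu x).1) hn hx₀
    hVc hV1 hVA hV u (M := G.mean u) (G.measurable_stripPayoff hn) hC hu hη fun k h => by
      have h1 := le_csSup (bddAbove_image u _) (mem_image_of_mem u (S.move_mem k h))
      have h2 := (hmu h.position).2.le
      have hα := (half_pos G.α_pos).le
      have h3 : (Strategy.ofMap m hm fun x => (hmu x).1).move k h = m h.position := rfl
      have h4 := mul_le_mul_of_nonneg_left h1 hα
      have h5 := mul_le_mul_of_nonneg_left h2 hα
      have h6 : G.α / 2 * (e / V x₀) ≤ 1 * (e / V x₀) :=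
        mul_le_mul_of_nonneg_right (by linarith [G.α_add_β, G.β_pos]) hη.le
      rw [h3, mean, ← G.integral_uniform]
      linarith
  rwa [div_mul_cancel₀ _ hVx.ne'] at this

theorem exists_strategy_ge (hn : 0 < n) {u : EuclideanSpace ℝ (Fin n) →ᵇ ℝ} (hu : G.SolvesDPP u)
    (hx₀ : x₀ ∈ G.extendedDomain) {e : ℝ} (he : 0 < e) :
    ∃ S : Strategy n G.ε, (∀ a : Information, a.Allows S) ∧
      ∀ T : Strategy n G.ε, u x₀ - e ≤ G.expectedPayoff S T x₀ := by
  obtain ⟨V, A, hVc, hV1, hVA, hV⟩ := G.exists_lyapunov hn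
  obtain ⟨C, hC⟩ := G.exists_abs_stripPayoff_le hn
  have hVx : 0 < V x₀ := by linarith [hV1 x₀]
  have hη : 0 < e / V x₀ := div_pos he hVx
  -- The change of sign of `u` and of the payoff exchanges the roles of the two players.
  obtain ⟨m, hm, hmu⟩ := exists_measurable_almost_minimizer (-u) G.ε_pos hη
  refine ⟨Strategy.ofMap m hm fun x => (hmu x).1, fun a => a.allows_ofMap _ _, fun T => ?_⟩
  have := G.integral_stopped_le_add (S := Strategy.ofMap m hm fun x => (hmu x).1) (T := T) hn hx₀
    hVc hV1 hVA hV (-u) (f := fun x => -G.stripPayoff x) (M := fun x => -G.mean u x)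
    (G.measurable_stripPayoff hn).neg (fun x => (abs_neg _).trans_le (hC x))
    (fun x hx => by
      have h1 := hu x hx
      rw [BoundedContinuousFunction.coe_neg, Pi.neg_apply, h1, mean]
      ring) hη fun k h => by
      have h1 := csInf_le (bddBelow_image u _) (mem_image_of_mem u (T.move_mem k h))
      have h2 := (hmu h.position).2.le
      rw [sInf_image_eq_neg_sSup] at h2
      simp only [BoundedContinuousFunction.coe_neg, Pi.neg_apply, neg_neg] at h2
      have hα := (half_pos G.α_pos).le
      have h3 : (Strategy.ofMap m hm fun x => (hmu x).1).move k h = m h.position := rfl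
      have h4 := mul_le_mul_of_nonneg_left h1 hα
      have h5 := mul_le_mul_of_nonneg_left h2 hα
      have h6 : G.α / 2 * (e / V x₀) ≤ 1 * (e / V x₀) :=
        mul_le_mul_of_nonneg_right (by linarith [G.α_add_β, G.β_pos]) hη.le
      simp only [BoundedContinuousFunction.coe_neg, Pi.neg_apply]
      rw [h3, mean, ← G.integral_uniform, integral_neg]
      linarith
  rw [div_mul_cancel₀ _ hVx.ne', integral_neg] at this
  change -G.expectedPayoff _ T x₀ ≤ -u x₀ + e at this
  linarith

/-- The uniform bound keeps all real suprema and infima away from their default values; the rest is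
sandwiching. -/
theorem iSup_iInf_eq_and_iInf_iSup_eq {X Y : Type*} [Nonempty X] [Nonempty Y] {f : X → Y → ℝ}
    {C v : ℝ} (hC : ∀ x y, |f x y| ≤ C) (hle : ∀ e > 0, ∃ y, ∀ x, f x y ≤ v + e)
    (hge : ∀ e > 0, ∃ x, ∀ y, v - e ≤ f x y) :
    (⨆ x, ⨅ y, f x y) = v ∧ (⨅ y, ⨆ x, f x y) = v := by
  have hbelow : ∀ x, BddBelow (range (f x)) := fun x =>
    ⟨-C, by rintro _ ⟨y, rfl⟩; exact (abs_le.1 (hC x y)).1⟩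
  have habove : ∀ y, BddAbove (range fun x => f x y) := fun y =>
    ⟨C, by rintro _ ⟨x, rfl⟩; exact (abs_le.1 (hC x y)).2⟩
  have hI : BddAbove (range fun x => ⨅ y, f x y) := by
    refine ⟨C, ?_⟩
    rintro _ ⟨x, rfl⟩
    obtain ⟨y⟩ := ‹Nonempty Y›
    exact (ciInf_le (hbelow x) y).trans (abs_le.1 (hC x y)).2
  have hII : BddBelow (range fun y => ⨆ x, f x y) := by
    refine ⟨-C, ?_⟩
    rintro _ ⟨y, rfl⟩
    obtain ⟨x⟩ := ‹Nonempty X›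
    exact (abs_le.1 (hC x y)).1.trans (le_ciSup (habove y) x)
  refine ⟨le_antisymm (le_of_forall_pos_le_add fun e he => ?_)
    (le_of_forall_pos_le_add fun e he => ?_), le_antisymm
    (le_of_forall_pos_le_add fun e he => ?_) (le_of_forall_pos_le_add fun e he => ?_)⟩
  · obtain ⟨y, hy⟩ := hle e he
    exact ciSup_le fun x => (ciInf_le (hbelow x) y).trans (hy x)
  · obtain ⟨x, hx⟩ := hge e he
    exact sub_le_iff_le_add.1 ((le_ciInf hx).trans (le_ciSup hI x))
  · obtain ⟨y, hy⟩ := hle e he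
    exact (ciInf_le hII y).trans (ciSup_le hy)
  · obtain ⟨x, hx⟩ := hge e he
    exact sub_le_iff_le_add.1 (le_ciInf fun y => (hx y).trans (le_ciSup (habove y) x))

theorem valueI_eq_and_valueII_eq (hn : 0 < n) {u : EuclideanSpace ℝ (Fin n) →ᵇ ℝ}
    (hu : G.SolvesDPP u) (hx₀ : x₀ ∈ G.extendedDomain) (a : Information) :
    G.valueI a x₀ = u x₀ ∧ G.valueII a x₀ = u x₀ := by
  obtain ⟨C, hC⟩ := G.exists_abs_stripPayoff_le hn
  have hbd : ∀ S T : Strategy n G.ε, |G.expectedPayoff S T x₀| ≤ C := fun S T => by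
    have := norm_integral_le_of_norm_le_const (μ := G.gameLaw S T x₀) (f := G.payoff)
      (ae_of_all _ fun ω => hC _)
    rwa [probReal_univ, mul_one] at this
  have : Nonempty {S : Strategy n G.ε // a.Allows S} :=
    let ⟨S, hS, _⟩ := G.exists_strategy_le hn hu hx₀ one_pos
    ⟨⟨S, hS a⟩⟩
  refine iSup_iInf_eq_and_iInf_iSup_eq
    (f := fun S T : {S : Strategy n G.ε // a.Allows S} => G.expectedPayoff S.1 T.1 x₀)
    (fun S T => hbd S.1 T.1) (fun e he => ?_) fun e he => ?_
  · obtain ⟨T, hTa, hT⟩ := G.exists_strategy_le hn hu hx₀ he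
    exact ⟨⟨T, hTa a⟩, fun S => hT S.1⟩
  · obtain ⟨S, hSa, hS⟩ := G.exists_strategy_ge hn hu hx₀ he
    exact ⟨⟨S, hSa a⟩, fun T => hS T.1⟩

end Value

end TugOfWar

end

theorem theorem4p2 {n : ℕ} (hn : 0 < n) (G : TugOfWar n) :
    (∀ S T : Strategy n G.ε, ∀ x₀ ∈ G.extendedDomain,
      (∀ᵐ ω ∂(G.gameLaw S T x₀), ∃ k, (ω k).1 = Outcome.stopped ∧ (ω k).2 ∈ G.strip) ∧
        Integrable G.payoff (G.gameLaw S T x₀)) ∧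
    ∃ u : EuclideanSpace ℝ (Fin n) → ℝ,
      ContinuousOn u G.extendedDomain ∧ G.SolvesDPP u ∧
      (∀ v : EuclideanSpace ℝ (Fin n) → ℝ,
        ContinuousOn v G.extendedDomain → G.SolvesDPP v → EqOn v u G.extendedDomain) ∧
      ∀ a : Information, ∀ x₀ ∈ G.extendedDomain,
        G.valueI a x₀ = u x₀ ∧ G.valueII a x₀ = u x₀ := by
  refine ⟨fun S T x₀ hx₀ => ⟨?_, ?_⟩, ?_⟩
  · filter_upwards [G.ae_exists_stopped (S := S) (T := T) hn hx₀, G.ae_admissible hn hx₀]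
      with ω ⟨k, hk⟩ hω
    exact ⟨k, hk, (hω k).2 hk⟩
  · obtain ⟨C, hC⟩ := G.exists_abs_stripPayoff_le hn
    exact G.integrable_stopped hn hx₀ (G.measurable_stripPayoff hn) hC
  · obtain ⟨u, hu⟩ := G.exists_solvesDPP hn
    refine ⟨u, u.continuous.continuousOn, hu, fun v hvc hv x hx => ?_,
      fun a x₀ hx₀ => G.valueI_eq_and_valueII_eq hn hu hx₀ a⟩
    -- Uniqueness: a competing solution, extended to a bounded continuous function, is again the
    -- value of the game. Any information alternative would serve.
    obtain ⟨w, hw⟩ := G.isCompact_extendedDomain.exists_boundedContinuousFunction_eqOn hvc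
    rw [← hw hx, ← (G.valueI_eq_and_valueII_eq hn (hv.congr hn hw.symm) hx .currentPoint).1,
      (G.valueI_eq_and_valueII_eq hn hu hx .currentPoint).1]
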